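/- Conventions. $\widehat\varphi(\omega)=\int_{\mathbb R}\varphi(t)e^{-it\omega}\,dt$; $\mathcal F[g]$ is the Fourier transform of a tempered distribution $g$ ($\langle\mathcal F[g],\varphi\rangle=\langle g,\widehat\varphi\rangle$); $\tilde f(x)=f(-x)$; $\mathcal S$ is the space of real Schwartz functions on $\mathbb R$; $K^+=K\,1_{[0,\infty)}$. Kernel. Let $K:\mathbb R\to\mathbb R$ ($K(0)$ may be infinite) be symmetric and positive off $0$, locally integrable, eventually decreasing with $K(t)\to0$ as $t\to\infty$, such that for every $\omega\ne0$ the improper integral $\int_0^\infty K(t)\cos(\omega t)\,dt$ converges to a positive number; moreover either $K\in L^1(\mathbb R)$, or $K\notin L^1(\mathbb R)$ and $\lim_{t\to\infty}t^{\alpha}K(t)\in(0,\infty)$ for some $\alpha\in(0,1)$. Let $\lambda>0$, $\beta\ge0$ and let the mass be $m=0$. Noise. Let $\dot W,F$ be stationary random distributions on a probability space $(\Omega,\mathbb P)$, i.e. linear maps $\mathcal S\to L^2(\Omega)$ with translation invariant covariance, such that $\mathbb E[\langle\dot W,\varphi\rangle\overline{\langle\dot W,\psi\rangle}]=\int\varphi\psi\,dt$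 and $\mathbb E[\langle F,\varphi\rangle\overline{\langle F,\psi\rangle}]=\int K(t)(\varphi*\tilde\psi)(t)\,dt$ for all $\varphi,\psi\in\mathcal S$. Weak solution. Let $\nu$ be a measure on $\mathbb R$, absolutely continuous with respect to Lebesgue measure, with $\int(1+x^2)^{-k}\,\nu(dx)<\infty$ for some integer $k$. Let $\xi$ be a centered Gaussian random measure with respect to $\nu$ on $\Omega$: a centered Gaussian family of complex random variables $\xi(E)$, indexed by the Borel sets $E$ with $\nu(E)<\infty$, with $\mathbb E[\xi(E_1)\overline{\xi(E_2)}]=\nu(E_1\cap E_2)$. Let $V$ be the operator $\langle V,g\rangle=\int_{\mathbb R}\overline{\mathcal F[g](\omega)}\,\xi(d\omega)$ whose domain $\mathrm{Dom}(V)$ consists of the tempered distributions $g$ such that $\mathcal F[g]$ is a function in $L^2(\nu)$. Suppose that $V$ is a weak solution of the generalized Langevin equation with parameters $m=0,\lambda,\beta$ and kernel $K$: (a) $K^+*\varphi\in\mathrm{Dom}(V)$ for all $\varphi\in\mathcal S$; (b) for all $\varphi,\psi\in\mathcal S$, with $A\varphi:=-m\varphi'+\lambda\varphi+\beta\,\widetilde{K^+*\tilde\varphi}$,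 $$\mathbb E\big[\langle V,A\varphi\rangle\overline{\langle V,A\psi\rangle}\big]=\mathbb E\big[\langle\sqrt{2\lambda}\,\dot W+\sqrt\beta F,\varphi\rangle\,\overline{\langle\sqrt{2\lambda}\,\dot W+\sqrt\beta F,\psi\rangle}\big].$$ Theorem. Under these hypotheses: 1. $\nu(\mathbb R)=\infty$, and the velocity $V(t)=\langle V,\delta_t\rangle$ is not defined: $\delta_t\notin\mathrm{Dom}(V)$ for every $t\in\mathbb R$. 2. $1_{[0,t]}\in\mathrm{Dom}(V)$ for every $t\ge0$, so that the position $X(t)=\langle V,1_{[0,t]}\rangle\in L^2(\Omega)$ is defined. 3. For every $T\ge0$ there is a constant $C>0$ such that $\mathbb E|X(t)-X(s)|^2\le C|t-s|^{1/2}$ for all $s,t\in[0,T]$. 4. $(X(t))_{t\ge0}$ has an a.s. continuous version: there is a process $(Y(t))_{t\ge0}$ with $Y(t)=X(t)$ a.s. for each $t\ge0$ whose paths are almost surely continuous on $[0,\infty)$. -/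

import Mathlib

open MeasureTheory ProbabilityTheory Filter Topology
open scoped ENNReal NNReal SchwartzMap FourierTransform ComplexConjugate Convolution

noncomputable section

namespace GLE

/-! ### Memory kernels -/

/-- The class of admissible memory kernels. The value `K 0` is irrelevant (the kernel may be
infinite at the origin): no condition below depends on it. -/
structure AdmissibleKernel (K : ℝ → ℝ) : Prop where
  symm : ∀ t, t ≠ 0 → K (-t) = K t
  pos : ∀ t, t ≠ 0 → 0 < K t
  tendsto_zero : Tendsto K atTop (𝓝 0)
  eventually_decreasing : ∃ A : ℝ, AntitoneOn K (Set.Ici A)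
  locallyIntegrable : LocallyIntegrable K volume
  /-- the improper Fourier cosine integral converges to a positive number -/
  cos_pos : ∀ ω : ℝ, ω ≠ 0 → ∃ L : ℝ, 0 < L ∧
    Tendsto (fun R : ℝ => ∫ t in (0 : ℝ)..R, K t * Real.cos (ω * t)) atTop (𝓝 L)
  /-- either `K` is integrable, or it is not and `K t ∼ t ^ (-α)`, up to a positive constant -/
  tail : Integrable K volume ∨
    (¬ Integrable K volume ∧ ∃ α : ℝ, 0 < α ∧ α < 1 ∧ ∃ C : ℝ, 0 < C ∧
      Tendsto (fun t : ℝ => K t / t ^ (-α)) atTop (𝓝 C))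

/-- `K⁺ = K · 1_{[0,∞)}`. -/
def plusPart (K : ℝ → ℝ) : ℝ → ℝ := (Set.Ici (0 : ℝ)).indicator K

/-- `f̃ (x) = f (-x)`. -/
def reflect (f : ℝ → ℝ) : ℝ → ℝ := fun x => f (-x)

/-- `(f * g) (t) = ∫ f (s) g (t - s) ds`. -/
def conv (f g : ℝ → ℝ) : ℝ → ℝ := f ⋆[ContinuousLinearMap.mul ℝ ℝ, volume] g

/-! ### Tempered distributions and their Fourier transform

The normalization is `φ̂ (ω) = ∫ φ (t) e^{-itω} dt`. -/

/-- The linear isomorphism `x ↦ (2π)⁻¹ x` of the real line. -/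
def scaleEquiv : ℝ ≃L[ℝ] ℝ :=
  ContinuousLinearEquiv.smulLeft (Units.mk0 ((2 * Real.pi)⁻¹ : ℝ) (by positivity))

/-- The Fourier transform `φ̂ (ω) = ∫ φ (t) e^{-itω} dt` on complex Schwartz functions. -/
def schwartzFourier : 𝓢(ℝ, ℂ) →L[ℂ] 𝓢(ℝ, ℂ) :=
  (SchwartzMap.compCLMOfContinuousLinearEquiv ℂ scaleEquiv).comp
    (FourierTransform.fourierCLM ℂ 𝓢(ℝ, ℂ))

theorem schwartzFourier_apply (φ : 𝓢(ℝ, ℂ)) (ω : ℝ) :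
    schwartzFourier φ ω = ∫ t, φ t * Complex.exp (-(Complex.I * t * ω)) := by
  have h : schwartzFourier φ ω = (𝓕 (φ : ℝ → ℂ)) ((2 * Real.pi)⁻¹ * ω) := rfl
  rw [h, Real.fourier_eq']
  refine integral_congr_ae (Eventually.of_forall fun t => ?_)
  have hpi : (Real.pi : ℂ) ≠ 0 := by exact_mod_cast Real.pi_ne_zero
  simp only [smul_eq_mul]
  rw [mul_comm]
  congr 2
  simp only [RCLike.inner_apply, conj_trivial]
  push_cast
  field_simp

/-- The Fourier transform of a tempered distribution: `⟨F[T], φ⟩ = ⟨T, φ̂⟩`. -/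
def distribFourier (T : 𝓢'(ℝ, ℂ)) : 𝓢'(ℝ, ℂ) :=
  PointwiseConvergenceCLM.precomp ℂ schwartzFourier T

theorem distribFourier_apply (T : 𝓢'(ℝ, ℂ)) (φ : 𝓢(ℝ, ℂ)) :
    distribFourier T φ = T (schwartzFourier φ) := rfl

/-- The tempered distribution `T` is given by the function `g`: `⟨T, φ⟩ = ∫ g φ`. -/
def Represents (T : 𝓢'(ℝ, ℂ)) (g : ℝ → ℂ) : Prop :=
  ∀ φ : 𝓢(ℝ, ℂ), Integrable (fun t => g t * φ t) volume ∧ T φ = ∫ t, g t * φ t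

/-- The function `g` defines a tempered distribution. -/
def IsTempered (g : ℝ → ℂ) : Prop := ∃ T, Represents T g

open Classical in
/-- The tempered distribution defined by the function `g` (`0` if there is none). -/
def ofFun (g : ℝ → ℂ) : 𝓢'(ℝ, ℂ) := if h : IsTempered g then h.choose else 0

theorem represents_ofFun {g : ℝ → ℂ} (h : IsTempered g) : Represents (ofFun g) g := by
  rw [ofFun, dif_pos h]
  exact h.choose_spec

/-- A function that represents a tempered distribution is unique almost everywhere. -/
theorem represents_unique {T : 𝓢'(ℝ, ℂ)} {g h : ℝ → ℂ} (hg : Represents T g)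
    (hh : Represents T h) : g =ᵐ[volume] h := by
  have hloc : ∀ {g : ℝ → ℂ}, Represents T g → LocallyIntegrable g volume := by
    intro g hg x
    let b : ContDiffBump x := ⟨1, 2, one_pos, one_lt_two⟩
    have hb : HasCompactSupport fun t => (b t : ℂ) :=
      b.hasCompactSupport.comp_left Complex.ofReal_zero
    have hb' : ContDiff ℝ (⊤ : ℕ∞) fun t => (b t : ℂ) :=
      Complex.ofRealCLM.contDiff.comp b.contDiff
    have hi := (hg (hb.toSchwartzMap hb')).1
    refine ⟨Metric.closedBall x 1, Metric.closedBall_mem_nhds x one_pos, ?_⟩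
    refine hi.integrableOn.congr_fun (fun t ht => ?_) measurableSet_closedBall
    have h1 : b t = 1 := b.one_of_mem_closedBall ht
    simp [h1]
  refine ae_eq_of_integral_contDiff_smul_eq (hloc hg) (hloc hh) fun u hu hc => ?_
  have hb : HasCompactSupport fun t => (u t : ℂ) := hc.comp_left Complex.ofReal_zero
  have hb' : ContDiff ℝ (⊤ : ℕ∞) fun t => (u t : ℂ) := Complex.ofRealCLM.contDiff.comp hu
  have h1 := (hg (hb.toSchwartzMap hb')).2
  rw [(hh (hb.toSchwartzMap hb')).2] at h1
  simpa [mul_comm] using h1.symm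

/-! ### Random measures and stochastic integrals -/

/-- The Borel sets of finite `ν`-measure. -/
abbrev FiniteSets (ν : Measure ℝ) : Type := {E : Set ℝ // MeasurableSet E ∧ ν E ≠ ∞}

/-- A centered Gaussian random measure with respect to `ν`: a map `ξ` from the Borel sets of finite
`ν`-measure to `L²(Ω)` with `𝔼[ξ(E₁) conj ξ(E₂)] = ν (E₁ ∩ E₂)`, which is a centered
(complex-valued) Gaussian family. -/
structure GaussianRandomMeasure (ν : Measure ℝ) {Ω : Type*} [MeasurableSpace Ω]
    (P : Measure Ω) where
  toFun : FiniteSets ν → Lp ℂ 2 P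
  covariance : ∀ E₁ E₂ : FiniteSets ν,
    ∫ x, toFun E₁ x * conj (toFun E₂ x) ∂P = ((ν (E₁.1 ∩ E₂.1)).toReal : ℂ)
  gaussian : IsGaussianProcess (fun (E : FiniteSets ν) (x : Ω) => toFun E x) P
  centered : ∀ E : FiniteSets ν, ∫ x, toFun E x ∂P = 0

/-- The indicator `1_E` as an element of `L²(ν)`. -/
def indicatorL2 (ν : Measure ℝ) (E : FiniteSets ν) : Lp ℂ 2 ν :=
  indicatorConstLp 2 E.2.1 E.2.2 (1 : ℂ)

namespace GaussianRandomMeasure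

variable {ν : Measure ℝ} {Ω : Type*} [MeasurableSpace Ω] {P : Measure Ω}

/-- The stochastic integral `L²(ν) → L²(Ω)`: the continuous linear extension of `1_E ↦ ξ(E)`. -/
def integralL2 (ξ : GaussianRandomMeasure ν P) : Lp ℂ 2 ν →L[ℂ] Lp ℂ 2 P :=
  (Finsupp.linearCombination ℂ ξ.toFun).extendOfNorm
    (Finsupp.linearCombination ℂ (indicatorL2 ν))

theorem inner_linearCombination_self {ι H : Type*} [NormedAddCommGroup H] [InnerProductSpace ℂ H]
    (f : ι → H) (c : ι →₀ ℂ) :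
    inner ℂ (Finsupp.linearCombination ℂ f c) (Finsupp.linearCombination ℂ f c)
      = ∑ i ∈ c.support, ∑ j ∈ c.support, conj (c i) * (c j * inner ℂ (f i) (f j)) := by
  rw [Finsupp.linearCombination_apply, Finsupp.sum, sum_inner]
  refine Finset.sum_congr rfl fun i _ => ?_
  rw [inner_sum]
  refine Finset.sum_congr rfl fun j _ => ?_
  rw [inner_smul_left, inner_smul_right]

theorem norm_linearCombination (ξ : GaussianRandomMeasure ν P) (c : FiniteSets ν →₀ ℂ) :
    ‖Finsupp.linearCombination ℂ ξ.toFun c‖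
      = ‖Finsupp.linearCombination ℂ (indicatorL2 ν) c‖ := by
  have key : ∀ E₁ E₂ : FiniteSets ν, inner ℂ (ξ.toFun E₁) (ξ.toFun E₂)
      = inner ℂ (indicatorL2 ν E₁) (indicatorL2 ν E₂) := by
    intro E₁ E₂
    have h1 : inner ℂ (ξ.toFun E₁) (ξ.toFun E₂)
        = ∫ x, ξ.toFun E₂ x * conj (ξ.toFun E₁ x) ∂P := by
      rw [L2.inner_def]
      rfl
    have h2 : inner ℂ (indicatorL2 ν E₁) (indicatorL2 ν E₂)
        = ((ν (E₂.1 ∩ E₁.1)).toReal : ℂ) := by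
      rw [indicatorL2, L2.inner_indicatorConstLp_one E₁.2.1 E₁.2.2, indicatorL2,
        setIntegral_congr_ae (g := E₂.1.indicator fun _ => (1 : ℂ)) E₁.2.1
          (indicatorConstLp_coeFn.mono fun x hx _ => hx),
        integral_indicator E₂.2.1, Measure.restrict_restrict E₂.2.1]
      simp [Measure.real]
    rw [h1, h2, ξ.covariance]
  rw [@norm_eq_sqrt_re_inner ℂ, @norm_eq_sqrt_re_inner ℂ _ _ _ _
    (Finsupp.linearCombination ℂ (indicatorL2 ν) c)]
  rw [inner_linearCombination_self, inner_linearCombination_self]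
  simp only [key]

theorem denseRange_linearCombination (ν : Measure ℝ) :
    DenseRange (Finsupp.linearCombination ℂ (indicatorL2 ν)) := by
  let S := (LinearMap.range (Finsupp.linearCombination ℂ (indicatorL2 ν))).topologicalClosure
  suffices h : ∀ f : Lp ℂ 2 ν, f ∈ S from fun f => h f
  refine Lp.induction (by simp) (motive := fun f => f ∈ S) ?_ ?_ ?_
  · intro c s hs hμ
    refine Submodule.le_topologicalClosure _ ⟨Finsupp.single ⟨s, hs, hμ.ne⟩ c, ?_⟩
    rw [Finsupp.linearCombination_single, Lp.simpleFunc.coe_indicatorConst, indicatorL2,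
      indicatorConstLp, indicatorConstLp, ← MemLp.toLp_const_smul]
    congr 1
    funext x
    by_cases hx : x ∈ s <;> simp [hx]
  · intro f g hf hg _ h1 h2
    exact S.add_mem h1 h2
  · exact Submodule.isClosed_topologicalClosure _

theorem integralL2_indicator (ξ : GaussianRandomMeasure ν P) (E : FiniteSets ν) :
    ξ.integralL2 (indicatorL2 ν E) = ξ.toFun E := by
  have h := LinearMap.extendOfNorm_eq (denseRange_linearCombination ν)
    (f := Finsupp.linearCombination ℂ ξ.toFun)
    ⟨1, fun c => by rw [one_mul, norm_linearCombination ξ c]⟩ (Finsupp.single E 1)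
  simpa [integralL2] using h

theorem norm_integralL2 (ξ : GaussianRandomMeasure ν P) (g : Lp ℂ 2 ν) :
    ‖ξ.integralL2 g‖ = ‖g‖ := by
  refine (denseRange_linearCombination ν).induction_on g
    (isClosed_eq (by fun_prop) (by fun_prop)) fun c => ?_
  have h := LinearMap.extendOfNorm_eq (denseRange_linearCombination ν)
    (f := Finsupp.linearCombination ℂ ξ.toFun)
    ⟨1, fun c => by rw [one_mul, norm_linearCombination ξ c]⟩ c
  rw [integralL2, h, norm_linearCombination]

open Classical in
/-- The stochastic integral `∫ g dξ` of a function `g ∈ L²(ν)` (`0` for other functions). -/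
def integral (ξ : GaussianRandomMeasure ν P) (g : ℝ → ℂ) : Lp ℂ 2 P :=
  if h : MemLp g 2 ν then ξ.integralL2 (h.toLp g) else 0

end GaussianRandomMeasure

/-! ### The operator associated with a spectral measure -/

/-- Spectral measures of extended stationary random distributions: absolutely continuous
measures of polynomial growth. -/
structure IsSpectralMeasure (ν : Measure ℝ) : Prop where
  growth : ∃ k : ℕ, ∫⁻ x : ℝ, ENNReal.ofReal (((1 + x ^ 2) ^ k)⁻¹) ∂ν < ∞
  absolutelyContinuous : ν ≪ volume

/-- The domain of the operator with spectral measure `ν`: the tempered distributions whose Fourier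
transform is a function that belongs to `L²(ν)`. -/
def Dom (ν : Measure ℝ) : Set 𝓢'(ℝ, ℂ) :=
  {T | ∃ h : ℝ → ℂ, Represents (distribFourier T) h ∧ MemLp h 2 ν}

open Classical in
/-- The operator `⟨V, T⟩ = ∫ conj F[T] dξ` for `T` in the domain (`0` outside of the domain). -/
def GaussianRandomMeasure.op {ν : Measure ℝ} {Ω : Type*} [MeasurableSpace Ω] {P : Measure Ω}
    (ξ : GaussianRandomMeasure ν P) (T : 𝓢'(ℝ, ℂ)) : Lp ℂ 2 P :=
  if h : T ∈ Dom ν then ξ.integral (fun ω => conj (h.choose ω)) else 0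

/-- The value of the operator does not depend on the function that represents `F[T]`. -/
theorem GaussianRandomMeasure.op_eq {ν : Measure ℝ} {Ω : Type*} [MeasurableSpace Ω] {P : Measure Ω}
    (ξ : GaussianRandomMeasure ν P) (hν : ν ≪ volume) {T : 𝓢'(ℝ, ℂ)} {h : ℝ → ℂ}
    (h1 : Represents (distribFourier T) h) (h2 : MemLp h 2 ν) :
    ξ.op T = ξ.integral (fun ω => conj (h ω)) := by
  have hT : T ∈ Dom ν := ⟨h, h1, h2⟩
  have hc := hT.choose_spec
  have huniq : hT.choose =ᵐ[volume] h := represents_unique hc.1 h1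
  have hconj : ∀ {g : ℝ → ℂ}, MemLp g 2 ν → MemLp (fun ω => conj (g ω)) 2 ν :=
    fun hg => hg.star
  rw [GaussianRandomMeasure.op, dif_pos hT, GaussianRandomMeasure.integral,
    GaussianRandomMeasure.integral, dif_pos (hconj hc.2), dif_pos (hconj h2)]
  congr 1
  rw [MemLp.toLp_eq_toLp_iff]
  filter_upwards [hν.ae_le huniq] with x hx
  rw [hx]

/-- The indicator function `1_{[0,t]}`. -/
def indicatorIcc (t : ℝ) : ℝ → ℂ := (Set.Icc 0 t).indicator 1

/-- The particle position `X(t) = ⟨V, 1_{[0,t]}⟩`. -/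
def GaussianRandomMeasure.position {ν : Measure ℝ} {Ω : Type*} [MeasurableSpace Ω] {P : Measure Ω}
    (ξ : GaussianRandomMeasure ν P) (t : ℝ≥0) : Lp ℂ 2 P :=
  ξ.op (ofFun (indicatorIcc t))

/-! ### Stationary random distributions and weak solutions -/

/-- A stationary random distribution: a linear map from the (real) Schwartz functions to `L²(Ω)`
whose covariance is invariant under translations. -/
structure StationaryRandomDistribution {Ω : Type*} [MeasurableSpace Ω] (P : Measure Ω) where
  toLin : 𝓢(ℝ, ℝ) →ₗ[ℝ] Lp ℂ 2 P
  stationary : ∀ (h : ℝ) (φ₁ φ₂ : 𝓢(ℝ, ℝ)),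
    ∫ x, toLin (SchwartzMap.compSubConstCLM ℝ (-h) φ₁) x
        * conj (toLin (SchwartzMap.compSubConstCLM ℝ (-h) φ₂) x) ∂P
      = ∫ x, toLin φ₁ x * conj (toLin φ₂ x) ∂P

/-- White noise: `𝔼[⟨W, φ₁⟩ conj ⟨W, φ₂⟩] = ∫ φ₁ φ₂`. -/
def IsWhiteNoise {Ω : Type*} [MeasurableSpace Ω] {P : Measure Ω}
    (W : StationaryRandomDistribution P) : Prop :=
  ∀ φ₁ φ₂ : 𝓢(ℝ, ℝ),
    ∫ x, W.toLin φ₁ x * conj (W.toLin φ₂ x) ∂P = ((∫ t, φ₁ t * φ₂ t : ℝ) : ℂ)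

/-- `K` is the covariance distribution of `F`:
`𝔼[⟨F, φ₁⟩ conj ⟨F, φ₂⟩] = ∫ K (t) (φ₁ * φ̃₂) (t) dt`. -/
def HasCovarianceKernel {Ω : Type*} [MeasurableSpace Ω] {P : Measure Ω}
    (F : StationaryRandomDistribution P) (K : ℝ → ℝ) : Prop :=
  ∀ φ₁ φ₂ : 𝓢(ℝ, ℝ),
    ∫ x, F.toLin φ₁ x * conj (F.toLin φ₂ x) ∂P = ((∫ t, K t * conv φ₁ (reflect φ₂) t : ℝ) : ℂ)

/-- The function `-m φ' + lam φ + β (K⁺ * φ̃)~` against which `V` is tested. -/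
def testFun (m lam β : ℝ) (K : ℝ → ℝ) (φ : 𝓢(ℝ, ℝ)) : ℝ → ℂ := fun t =>
  ((-m * deriv φ t + lam * φ t + β * reflect (conv (plusPart K) (reflect φ)) t : ℝ) : ℂ)

/-- The operator with spectral measure `ν` and random measure `ξ` is a weak solution of the
generalized Langevin equation
`m dV = -lam V dt - β (K⁺ * V) dt + √β F dt + √(2 lam) dW`. -/
structure IsWeakSolution {ν : Measure ℝ} {Ω : Type*} [MeasurableSpace Ω] {P : Measure Ω}
    (m lam β : ℝ) (K : ℝ → ℝ) (W F : StationaryRandomDistribution P)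
    (ξ : GaussianRandomMeasure ν P) : Prop where
  isSpectralMeasure : IsSpectralMeasure ν
  mem_dom : ∀ φ : 𝓢(ℝ, ℝ), IsTempered (fun t => (conv (plusPart K) φ t : ℂ)) ∧
    ofFun (fun t => (conv (plusPart K) φ t : ℂ)) ∈ Dom ν
  covariance : ∀ φ ψ : 𝓢(ℝ, ℝ),
    ∫ x, ξ.op (ofFun (testFun m lam β K φ)) x * conj (ξ.op (ofFun (testFun m lam β K ψ)) x) ∂P
      = ∫ x, (Real.sqrt (2 * lam) • W.toLin φ + Real.sqrt β • F.toLin φ) x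
          * conj ((Real.sqrt (2 * lam) • W.toLin ψ + Real.sqrt β • F.toLin ψ) x) ∂P

end GLE

end

noncomputable section

/-! ### Oscillatory integrals of decreasing functions. -/

namespace GLE

/-! On the Fourier side the massless equation is multiplication by the symbol `z(ω) = lam + β ∫₀^∞
K(t) e^{iωt} dt`. If the two noises were uncorrelated, `ν` would have density `Re z / (π |z|²)`. No
correlation assumption links `W` and `F`, so no formula for `ν` is available; but comparisons up to
constants suffice.

The comparisons come from testing the equation with real functions whose Fourier transform is an
even `ρ` supported in an annulus `δ ≤ |ω| ≤ R`. Evenness makes the test function real, and vanishing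
near `0` avoids the possible singularity of `z` there. The equation then reads `∫ |z|² ρ² dν = ‖√(2
lam) W + √β F‖²`, where the white part has squared norm `(lam/π) ∫ ρ²` and the coloured part `(β/π)
∫ Re(K̂⁺) ρ²`, with `K̂⁺` the half-line transform `halfFourier K` (`norm_sq_noise`,
`norm_sq_whiteNoise`, `norm_sq_colouredNoise`).

Upper bound: the triangle inequality gives at most `(2/π) ∫ Re z ρ²`. Since `Re K̂⁺ ≥ 0`, one has
`|z| ≥ Re z ≥ lam`; dividing by `|z|²` yields `ν ≤ c · Lebesgue` with `c = 8/(π lam)`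
(`spectralMeasure_le`). Lower bound: `K̂⁺` tends to `0` at infinity, so at high frequencies the
coloured part is at most half of the white part in norm. There `ν` dominates a multiple of Lebesgue
measure on even test functions, and its total mass is infinite (`spectralMeasure_univ`).

The rest follows. The transform of `δ_t` has modulus one, so it is not in `L²(ν)`. The transform of
an indicator is square integrable for Lebesgue measure, hence for `ν`, and the increments of the
position satisfy `𝔼|X(t) - X(s)|² ≤ 4πc |t - s|`, stronger than the required exponent `1/2` on
bounded intervals. As the stochastic integral is Gaussian, the fourth moments are `O(|t - s|²)`, and
a dyadic Kolmogorov argument (`exists_continuous_version`) gives continuity. -/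

theorem intervalIntegrable_ofReal {f : ℝ → ℝ} {a b : ℝ} (h : IntervalIntegrable f volume a b) :
    IntervalIntegrable (fun t => (f t : ℂ)) volume a b :=
  ⟨h.1.ofReal, h.2.ofReal⟩

/-- The integrals of a decreasing positive function against a character, by translation by half a
period. -/
theorem norm_integral_mul_exp_le_of_antitoneOn {f : ℝ → ℝ} {a b ω : ℝ} (hab : a ≤ b)
    (hf : AntitoneOn f (Set.Ici a)) (hpos : ∀ t ∈ Set.Ici a, 0 ≤ f t) (hω : ω ≠ 0) :
    ‖∫ t in a..b, (f t : ℂ) * Complex.exp (Complex.I * ω * t)‖ ≤ 2 * Real.pi * f a / |ω| := by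
  set h : ℝ := Real.pi / |ω| with hh
  have hω' : 0 < |ω| := abs_pos.mpr hω
  have hhpos : 0 < h := by positivity
  set e : ℝ → ℂ := fun t => Complex.exp (Complex.I * ω * t) with he
  have hecont : Continuous e := by fun_prop
  have henorm : ∀ t, ‖e t‖ = 1 := fun t => by
    have : Complex.I * ω * t = ((ω * t : ℝ) : ℂ) * Complex.I := by push_cast; ring
    simp only [he, this, Complex.norm_exp_ofReal_mul_I]
  have heh : ∀ t, e (t + h) = - e t := fun t => by
    simp only [he]
    rcases abs_choice ω with h1 | h1
    · have : Complex.I * ω * ((t + h : ℝ) : ℂ) = Complex.I * ω * t + Real.pi * Complex.I := by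
        have h2 : ω * h = Real.pi := by rw [hh, h1]; field_simp
        rw [← h2]; push_cast; ring
      rw [this, Complex.exp_add, Complex.exp_pi_mul_I]; ring
    · have : Complex.I * ω * ((t + h : ℝ) : ℂ) = Complex.I * ω * t - Real.pi * Complex.I := by
        have h2 : -(ω * h) = Real.pi := by rw [hh, h1]; field_simp
        rw [← h2]; push_cast; ring
      rw [this, Complex.exp_sub, Complex.exp_pi_mul_I]; ring
  have hi : ∀ c d : ℝ, a ≤ c → a ≤ d → IntervalIntegrable f volume c d := fun c d hc hd => by
    refine AntitoneOn.intervalIntegrable (hf.mono fun x hx => ?_)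
    rw [Set.mem_uIcc] at hx
    rcases hx with hx | hx
    · exact hc.trans hx.1
    · exact hd.trans hx.1
  have hiC : ∀ c d : ℝ, a ≤ c → a ≤ d →
      IntervalIntegrable (fun t => (f t : ℂ) * e t) volume c d := fun c d hc hd =>
    IntervalIntegrable.mul_continuousOn (intervalIntegrable_ofReal (hi c d hc hd)) hecont.continuousOn
  have his : IntervalIntegrable (fun t => f (t + h)) volume a b := by
    have := (hi (a + h) (b + h) (by linarith) (by linarith)).comp_add_right h
    simpa using this
  have hisC : IntervalIntegrable (fun t => (f (t + h) : ℂ) * e (t + h)) volume a b :=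
    IntervalIntegrable.mul_continuousOn (intervalIntegrable_ofReal his) (by fun_prop)
  have hnc : ∀ c : ℝ, a ≤ c → ‖∫ t in c..(c + h), (f t : ℂ) * e t‖ ≤ f a * h := fun c hc => by
    have := intervalIntegral.norm_integral_le_of_norm_le_const (a := c) (b := c + h)
      (f := fun t => (f t : ℂ) * e t) (C := f a) fun t ht => by
        rw [Set.uIoc_of_le (by linarith)] at ht
        have hta : a ≤ t := by linarith [ht.1]
        rw [norm_mul, henorm, mul_one, Complex.norm_real, Real.norm_of_nonneg (hpos t hta)]
        exact hf Set.self_mem_Ici hta hta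
    simpa [abs_of_pos hhpos] using this
  -- Since `f` decreases, `f t - f (t + h)` is nonnegative, so the norm bound is an exact integral
  -- that telescopes to the two end pieces.
  have hdiff : ‖∫ t in a..b, ((f t : ℂ) * e (t + h) - (f (t + h) : ℂ) * e (t + h))‖ ≤ f a * h := by
    have h1 : ‖∫ t in a..b, ((f t : ℂ) * e (t + h) - (f (t + h) : ℂ) * e (t + h))‖
        ≤ ∫ t in a..b, (f t - f (t + h)) := by
      refine intervalIntegral.norm_integral_le_of_norm_le hab
        (Eventually.of_forall fun t ht => ?_) ((hi a b le_rfl hab).sub his)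
      have hta : a ≤ t := ht.1.le
      rw [← sub_mul, norm_mul, henorm, mul_one, ← Complex.ofReal_sub, Complex.norm_real,
        Real.norm_of_nonneg]
      exact sub_nonneg.mpr (hf hta (by simp; linarith) (by linarith))
    have h2 : ∫ t in a..b, (f t - f (t + h))
        = (∫ t in a..(a + h), f t) - ∫ t in b..(b + h), f t := by
      rw [intervalIntegral.integral_sub (hi a b le_rfl hab) his,
        intervalIntegral.integral_comp_add_right (fun t => f t) h]
      have e1 := intervalIntegral.integral_add_adjacent_intervals (hi a (a + h) le_rfl (by linarith))
        (hi (a + h) (b + h) (by linarith) (by linarith))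
      have e2 := intervalIntegral.integral_add_adjacent_intervals (hi a b le_rfl hab)
        (hi b (b + h) hab (by linarith))
      linarith
    have h3 : ∫ t in a..(a + h), f t ≤ f a * h := by
      have := intervalIntegral.integral_mono_on (a := a) (b := a + h) (by linarith)
        (hi a (a + h) le_rfl (by linarith)) (intervalIntegrable_const (c := f a))
        fun t ht => hf Set.self_mem_Ici ht.1 ht.1
      simpa [mul_comm] using this
    have h4 : 0 ≤ ∫ t in b..(b + h), f t :=
      intervalIntegral.integral_nonneg (by linarith) fun t ht => hpos t (hab.trans ht.1)
    linarith
  have hid : ∫ t in a..b, ((f t : ℂ) * e (t + h) - (f (t + h) : ℂ) * e (t + h))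
      = -(∫ t in a..b, (f t : ℂ) * e t) - (∫ t in a..b, (f t : ℂ) * e t)
        + (∫ t in a..(a + h), (f t : ℂ) * e t) - ∫ t in b..(b + h), (f t : ℂ) * e t := by
    rw [intervalIntegral.integral_sub _ hisC,
      intervalIntegral.integral_comp_add_right (fun t => (f t : ℂ) * e t) h]
    · have e1 := intervalIntegral.integral_add_adjacent_intervals
        (hiC a (a + h) le_rfl (by linarith)) (hiC (a + h) (b + h) (by linarith) (by linarith))
      have e2 := intervalIntegral.integral_add_adjacent_intervals (hiC a b le_rfl hab)
        (hiC b (b + h) hab (by linarith))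
      simp only [heh, mul_neg, intervalIntegral.integral_neg]
      linear_combination -e1 + e2
    · simp only [heh, mul_neg]
      exact (hiC a b le_rfl hab).neg
  -- Because `e (t + h) = -e t`, shifting by half a period reproduces the integral with the opposite
  -- sign, up to two end pieces and the integral of the differences. Each of the three is at most `f
  -- a * h`.
  have h2I : (2 : ℂ) * ∫ t in a..b, (f t : ℂ) * e t
      = (∫ t in a..(a + h), (f t : ℂ) * e t) - (∫ t in b..(b + h), (f t : ℂ) * e t)
        - ∫ t in a..b, ((f t : ℂ) * e (t + h) - (f (t + h) : ℂ) * e (t + h)) := by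
    rw [hid]; ring
  have h3 : 2 * ‖∫ t in a..b, (f t : ℂ) * e t‖ ≤ 3 * (f a * h) := by
    calc 2 * ‖∫ t in a..b, (f t : ℂ) * e t‖ = ‖(2 : ℂ) * ∫ t in a..b, (f t : ℂ) * e t‖ := by simp
      _ ≤ _ := by
        rw [h2I]
        refine (norm_sub_le _ _).trans ?_
        have := norm_sub_le (∫ t in a..(a + h), (f t : ℂ) * e t) (∫ t in b..(b + h), (f t : ℂ) * e t)
        linarith [hnc a le_rfl, hnc b hab]
  have hfa : 0 ≤ f a * h := mul_nonneg (hpos a Set.self_mem_Ici) hhpos.le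
  have h4 : 2 * Real.pi * f a / |ω| = 2 * (f a * h) := by rw [hh]; ring
  rw [h4]
  linarith

/-- The truncated half-line Fourier transform `∫₀ᴿ f (t) e^{iωt} dt`. -/
def halfTrunc (f : ℝ → ℝ) (R ω : ℝ) : ℂ :=
  ∫ t in (0 : ℝ)..R, (f t : ℂ) * Complex.exp (Complex.I * ω * t)

/-- The half-line Fourier transform `∫₀^∞ f (t) e^{iωt} dt`, as an improper integral. -/
def halfFourier (f : ℝ → ℝ) (ω : ℝ) : ℂ :=
  if ω = 0 then 0 else limUnder atTop fun R => halfTrunc f R ω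

theorem norm_exp_I_mul (ω t : ℝ) : ‖Complex.exp (Complex.I * ω * t)‖ = 1 := by
  have : Complex.I * ω * t = ((ω * t : ℝ) : ℂ) * Complex.I := by push_cast; ring
  rw [this, Complex.norm_exp_ofReal_mul_I]

/-! ### The half-line Fourier transform of the kernel: existence, bounds, symmetry. -/

namespace AdmissibleKernel

variable {K : ℝ → ℝ}

theorem exists_antitoneOn (hK : AdmissibleKernel K) :
    ∃ A : ℝ, 0 < A ∧ AntitoneOn K (Set.Ici A) ∧ ∀ t ∈ Set.Ici A, 0 ≤ K t := by
  obtain ⟨A, hA⟩ := hK.eventually_decreasing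
  refine ⟨max A 1, by positivity, hA.mono (Set.Ici_subset_Ici.mpr (le_max_left _ _)), fun t ht => ?_⟩
  have : (1 : ℝ) ≤ t := (le_max_right _ _).trans ht
  exact (hK.pos t (by positivity)).le

theorem intervalIntegrable (hK : AdmissibleKernel K) (a b : ℝ) :
    IntervalIntegrable K volume a b :=
  (hK.locallyIntegrable.integrableOn_isCompact isCompact_uIcc).intervalIntegrable

theorem intervalIntegrable_mul_exp (hK : AdmissibleKernel K) (ω a b : ℝ) :
    IntervalIntegrable (fun t => (K t : ℂ) * Complex.exp (Complex.I * ω * t)) volume a b :=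
  (intervalIntegrable_ofReal (hK.intervalIntegrable a b)).mul_continuousOn (by fun_prop)

theorem norm_halfTrunc_sub_le (hK : AdmissibleKernel K) {A : ℝ}
    (hA : AntitoneOn K (Set.Ici A)) (hpos : ∀ t ∈ Set.Ici A, 0 ≤ K t) {a b ω : ℝ}
    (ha : A ≤ a) (hab : a ≤ b) (hω : ω ≠ 0) :
    ‖halfTrunc K b ω - halfTrunc K a ω‖ ≤ 2 * Real.pi * K a / |ω| := by
  rw [halfTrunc, halfTrunc, intervalIntegral.integral_interval_sub_left
    (hK.intervalIntegrable_mul_exp ω 0 b) (hK.intervalIntegrable_mul_exp ω 0 a)]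
  exact norm_integral_mul_exp_le_of_antitoneOn hab (hA.mono (Set.Ici_subset_Ici.mpr ha))
    (fun t ht => hpos t (ha.trans ht)) hω

/-- The tails are bounded by `2π K(R) / |ω|` with `K(R) → 0`, so the Cauchy criterion applies. This
also covers the sine part, about which the hypothesis on cosine integrals says nothing. -/
theorem tendsto_halfTrunc (hK : AdmissibleKernel K) {ω : ℝ} (hω : ω ≠ 0) :
    Tendsto (fun R => halfTrunc K R ω) atTop (𝓝 (halfFourier K ω)) := by
  obtain ⟨A, hA0, hA, hpos⟩ := hK.exists_antitoneOn
  rw [halfFourier, if_neg hω]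
  refine CauchySeq.tendsto_limUnder ?_
  refine Metric.cauchySeq_iff'.mpr fun ε hε => ?_
  have h0 : Tendsto (fun R => 2 * Real.pi * K R / |ω|) atTop (𝓝 0) := by
    have := (hK.tendsto_zero.const_mul (2 * Real.pi)).div_const |ω|
    simpa using this
  obtain ⟨N, hN1, hN2⟩ := ((h0.eventually (gt_mem_nhds hε)).and (eventually_ge_atTop A)).exists
  refine ⟨N, fun n hn => ?_⟩
  rw [dist_eq_norm]
  exact (hK.norm_halfTrunc_sub_le hA hpos hN2 hn hω).trans_lt hN1

theorem norm_halfFourier_sub_le (hK : AdmissibleKernel K) {A : ℝ}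
    (hA : AntitoneOn K (Set.Ici A)) (hpos : ∀ t ∈ Set.Ici A, 0 ≤ K t) {ω : ℝ} (hω : ω ≠ 0) :
    ‖halfFourier K ω - halfTrunc K A ω‖ ≤ 2 * Real.pi * K A / |ω| := by
  refine le_of_tendsto ((hK.tendsto_halfTrunc hω).sub_const _).norm ?_
  filter_upwards [eventually_ge_atTop A] with R hR
  exact hK.norm_halfTrunc_sub_le hA hpos le_rfl hR hω

theorem re_halfFourier_pos (hK : AdmissibleKernel K) {ω : ℝ} (hω : ω ≠ 0) :
    0 < (halfFourier K ω).re := by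
  obtain ⟨L, hL, hlim⟩ := hK.cos_pos ω hω
  have h1 : Tendsto (fun R => (halfTrunc K R ω).re) atTop (𝓝 (halfFourier K ω).re) :=
    (Complex.continuous_re.tendsto _).comp (hK.tendsto_halfTrunc hω)
  have h2 : ∀ R, (halfTrunc K R ω).re = ∫ t in (0 : ℝ)..R, K t * Real.cos (ω * t) := by
    intro R
    have := Complex.reCLM.intervalIntegral_comp_comm (hK.intervalIntegrable_mul_exp ω 0 R)
    simp only [Complex.reCLM_apply] at this
    rw [halfTrunc, ← this]
    refine intervalIntegral.integral_congr fun t _ => ?_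
    have : Complex.I * ω * t = ((ω * t : ℝ) : ℂ) * Complex.I := by push_cast; ring
    simp only [this, Complex.re_ofReal_mul, Complex.exp_ofReal_mul_I_re]
  simp only [h2] at h1
  rw [tendsto_nhds_unique h1 hlim]
  exact hL

theorem re_halfFourier_nonneg (hK : AdmissibleKernel K) (ω : ℝ) : 0 ≤ (halfFourier K ω).re := by
  by_cases hω : ω = 0
  · simp [halfFourier, hω]
  · exact (hK.re_halfFourier_pos hω).le

theorem halfTrunc_neg (f : ℝ → ℝ) (R ω : ℝ) : halfTrunc f R (-ω) = conj (halfTrunc f R ω) := by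
  have hc : ∀ g : ℝ → ℂ, conj (∫ t in (0 : ℝ)..R, g t) = ∫ t in (0 : ℝ)..R, conj (g t) :=
    fun g => by simp only [intervalIntegral, map_sub, ← integral_conj]
  rw [halfTrunc, halfTrunc, hc]
  refine intervalIntegral.integral_congr fun t _ => ?_
  simp [← Complex.exp_conj]

theorem halfFourier_neg (hK : AdmissibleKernel K) (ω : ℝ) :
    halfFourier K (-ω) = conj (halfFourier K ω) := by
  by_cases hω : ω = 0
  · simp [halfFourier, hω]
  · refine tendsto_nhds_unique (hK.tendsto_halfTrunc (neg_ne_zero.mpr hω)) ?_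
    simp only [halfTrunc_neg]
    exact (Complex.continuous_conj.tendsto _).comp (hK.tendsto_halfTrunc hω)

theorem norm_halfTrunc_le (hK : AdmissibleKernel K) {R : ℝ} (hR : 0 ≤ R) (ω : ℝ) :
    ‖halfTrunc K R ω‖ ≤ ∫ t in (0 : ℝ)..R, |K t| := by
  rw [halfTrunc]
  refine intervalIntegral.norm_integral_le_of_norm_le hR (Eventually.of_forall fun t _ => ?_)
    (hK.intervalIntegrable 0 R).abs
  rw [norm_mul, norm_exp_I_mul, mul_one, Complex.norm_real, Real.norm_eq_abs]

/-- The truncated transforms are bounded away from the origin, uniformly in the truncation. -/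
theorem exists_norm_halfTrunc_le (hK : AdmissibleKernel K) : ∃ A B : ℝ, 0 ≤ B ∧
    ∀ R ω : ℝ, A ≤ R → ω ≠ 0 → ‖halfTrunc K R ω‖ ≤ B * (1 + |ω|⁻¹) := by
  obtain ⟨A, hA0, hA, hpos⟩ := hK.exists_antitoneOn
  have hKA := hpos A Set.self_mem_Ici
  have hI : 0 ≤ ∫ t in (0 : ℝ)..A, |K t| :=
    intervalIntegral.integral_nonneg hA0.le fun t _ => abs_nonneg _
  refine ⟨A, (∫ t in (0 : ℝ)..A, |K t|) + 2 * Real.pi * K A, by positivity, fun R ω hR hω => ?_⟩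
  have h1 := hK.norm_halfTrunc_sub_le hA hpos le_rfl hR hω
  have h2 := hK.norm_halfTrunc_le hA0.le ω
  have h3 := norm_le_norm_sub_add (halfTrunc K R ω) (halfTrunc K A ω)
  have h4 : 0 ≤ (∫ t in (0 : ℝ)..A, |K t|) * |ω|⁻¹ := by positivity
  have h5 : 0 ≤ 2 * Real.pi * K A := by positivity
  rw [div_eq_mul_inv] at h1
  nlinarith

theorem exists_norm_halfFourier_le (hK : AdmissibleKernel K) : ∃ B : ℝ, 0 ≤ B ∧
    ∀ ω : ℝ, ω ≠ 0 → ‖halfFourier K ω‖ ≤ B * (1 + |ω|⁻¹) := by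
  obtain ⟨A, B, hB, h⟩ := hK.exists_norm_halfTrunc_le
  refine ⟨B, hB, fun ω hω => le_of_tendsto (hK.tendsto_halfTrunc hω).norm ?_⟩
  filter_upwards [eventually_ge_atTop A] with R hR
  exact h R ω hR hω

theorem continuous_halfTrunc (hK : AdmissibleKernel K) (R : ℝ) :
    Continuous fun ω => halfTrunc K R ω := by
  unfold halfTrunc
  refine intervalIntegral.continuous_of_dominated_interval (bound := fun t => |K t|)
    (fun ω => (intervalIntegrable_iff.mp (hK.intervalIntegrable_mul_exp ω 0 R)).aestronglyMeasurable)
    (fun ω => Eventually.of_forall fun t _ => ?_) (hK.intervalIntegrable 0 R).abs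
    (Eventually.of_forall fun t _ => by fun_prop)
  rw [norm_mul, norm_exp_I_mul, mul_one, Complex.norm_real, Real.norm_eq_abs]

theorem measurable_halfFourier (hK : AdmissibleKernel K) : Measurable (halfFourier K) := by
  refine measurable_of_tendsto_metrizable
    (f := fun n : ℕ => fun ω : ℝ => if ω = 0 then 0 else halfTrunc K n ω)
    (fun n => Measurable.ite (measurableSet_singleton 0) measurable_const
      (hK.continuous_halfTrunc n).measurable) ?_
  rw [tendsto_pi_nhds]
  intro ω
  by_cases hω : ω = 0
  · simp [halfFourier, hω]
  · simp only [hω, if_false]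
    exact (hK.tendsto_halfTrunc hω).comp tendsto_natCast_atTop_atTop

/-- The half-line Fourier transform of the kernel vanishes at infinity. -/
theorem tendsto_halfFourier (hK : AdmissibleKernel K) :
    Tendsto (halfFourier K) (cocompact ℝ) (𝓝 0) := by
  obtain ⟨A, hA0, hA, hpos⟩ := hK.exists_antitoneOn
  have hscale : Tendsto (fun ω : ℝ => -(2 * Real.pi)⁻¹ * ω) (cocompact ℝ) (cocompact ℝ) :=
    (Homeomorph.mulLeft₀ (-(2 * Real.pi)⁻¹ : ℝ)
      (by simp [Real.pi_ne_zero])).isClosedEmbedding.tendsto_cocompact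
  -- The Riemann–Lebesgue lemma on `(0, A]`; the factor `-(2π)⁻¹` converts between the two
  -- normalizations of the character. The tail beyond `A` is `O(1/|ω|)`.
  have h1 : Tendsto (fun ω => halfTrunc K A ω) (cocompact ℝ) (𝓝 0) := by
    have h := (Real.tendsto_integral_exp_smul_cocompact
      ((Set.Ioc 0 A).indicator fun t => (K t : ℂ))).comp hscale
    refine h.congr fun ω => ?_
    rw [halfTrunc, intervalIntegral.integral_of_le hA0.le, ← integral_indicator measurableSet_Ioc]
    refine integral_congr_ae (Eventually.of_forall fun t => ?_)
    by_cases ht : t ∈ Set.Ioc 0 A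
    · simp only [Set.indicator_of_mem ht, Circle.smul_def, Real.fourierChar_apply, smul_eq_mul]
      rw [mul_comm]
      congr 2
      have hpi : (Real.pi : ℂ) ≠ 0 := by exact_mod_cast Real.pi_ne_zero
      push_cast
      field_simp
    · simp only [Set.indicator_of_notMem ht, smul_zero]
  have h2 : Tendsto (fun ω : ℝ => 2 * Real.pi * K A / |ω|) (cocompact ℝ) (𝓝 0) :=
    tendsto_const_nhds.div_atTop (tendsto_norm_cocompact_atTop (E := ℝ))
  have h3 : Tendsto (fun ω => halfFourier K ω - halfTrunc K A ω) (cocompact ℝ) (𝓝 0) := by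
    refine squeeze_zero_norm' ?_ h2
    filter_upwards [(isCompact_singleton (x := (0 : ℝ))).compl_mem_cocompact] with ω hω
    exact hK.norm_halfFourier_sub_le hA hpos hω
  simpa using h3.add h1

end AdmissibleKernel

/-! ### The Fourier transform of Schwartz functions -/

theorem norm_exp_neg_I_mul_mul (x y : ℝ) : ‖Complex.exp (-(Complex.I * x * y))‖ = 1 := by
  have : -(Complex.I * x * y) = ((-(x * y) : ℝ) : ℂ) * Complex.I := by push_cast; ring
  rw [this, Complex.norm_exp_ofReal_mul_I]

theorem integrable_mul_exp {f : ℝ → ℂ} (hf : Integrable f) (y : ℝ) :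
    Integrable fun t : ℝ => f t * Complex.exp (-(Complex.I * t * y)) :=
  hf.mul_bdd (c := 1) (by fun_prop)
    (Eventually.of_forall fun t => (norm_exp_neg_I_mul_mul t y).le)

/-- The multiplication formula for the Fourier transform. -/
theorem integral_mul_integral_exp_swap {f g : ℝ → ℂ} (hf : Integrable f) (hg : Integrable g) :
    ∫ t : ℝ, f t * ∫ ω : ℝ, g ω * Complex.exp (-(Complex.I * ω * t))
      = ∫ ω : ℝ, (∫ t : ℝ, f t * Complex.exp (-(Complex.I * t * ω))) * g ω := by
  have hfg : Integrable (fun p : ℝ × ℝ => f p.1 * g p.2 * Complex.exp (-(Complex.I * p.1 * p.2)))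
      (volume.prod volume) := by
    refine (hf.mul_prod hg).mul_bdd (c := 1) (by fun_prop)
      (Eventually.of_forall fun p => (norm_exp_neg_I_mul_mul p.1 p.2).le)
  have h := integral_integral_swap (f := fun t ω : ℝ =>
    f t * g ω * Complex.exp (-(Complex.I * t * ω))) hfg
  calc _ = ∫ t : ℝ, ∫ ω : ℝ, f t * g ω * Complex.exp (-(Complex.I * t * ω)) := by
        refine integral_congr_ae (Eventually.of_forall fun t => ?_)
        simp only
        rw [← integral_const_mul]
        refine integral_congr_ae (Eventually.of_forall fun ω => ?_)
        simp only
        rw [mul_right_comm Complex.I (ω : ℂ) (t : ℂ)]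
        ring
    _ = _ := h
    _ = _ := by
        refine integral_congr_ae (Eventually.of_forall fun ω => ?_)
        simp only
        rw [← integral_mul_const]
        refine integral_congr_ae (Eventually.of_forall fun t => ?_)
        simp only
        ring

theorem schwartzFourier_schwartzFourier (f : 𝓢(ℝ, ℂ)) (x : ℝ) :
    schwartzFourier (schwartzFourier f) x = 2 * Real.pi * f (-x) := by
  have h0 : ∀ ω, schwartzFourier f ω = (𝓕 f) ((2 * Real.pi)⁻¹ * ω) := fun ω => rfl
  have hpi : (Real.pi : ℂ) ≠ 0 := by exact_mod_cast Real.pi_ne_zero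
  have h1 : f (-x) = ∫ v : ℝ, Complex.exp (-(Complex.I * v * (2 * Real.pi * x))) * (𝓕 f) v := by
    have h2 : 𝓕⁻ (𝓕 f) = f := FourierTransform.fourierInv_fourier_eq f
    conv_lhs => rw [← h2]
    rw [SchwartzMap.fourierInv_coe, Real.fourierInv_eq']
    refine integral_congr_ae (Eventually.of_forall fun v => ?_)
    simp only [smul_eq_mul]
    congr 2
    simp only [RCLike.inner_apply, conj_trivial]
    push_cast
    ring
  rw [schwartzFourier_apply, h1]
  have h3 := Measure.integral_comp_mul_left (fun v : ℝ =>
    Complex.exp (-(Complex.I * v * (2 * Real.pi * x))) * (𝓕 f) v) (2 * Real.pi)⁻¹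
  have h4 : |((2 * Real.pi)⁻¹)⁻¹| = 2 * Real.pi := by
    rw [inv_inv, abs_of_pos (by positivity)]
  rw [h4] at h3
  rw [Complex.real_smul] at h3
  push_cast at h3
  rw [← h3]
  refine integral_congr_ae (Eventually.of_forall fun t => ?_)
  simp only [h0]
  rw [mul_comm]
  congr 2
  field_simp

/-- The Fourier transform of a translate. -/
theorem integral_comp_add_mul_exp (f : ℝ → ℂ) (s ω : ℝ) :
    ∫ t : ℝ, f (t + s) * Complex.exp (-(Complex.I * t * ω))
      = Complex.exp (Complex.I * ω * s) * ∫ t : ℝ, f t * Complex.exp (-(Complex.I * t * ω)) := by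
  rw [← integral_const_mul,
    ← integral_add_right_eq_self (fun t : ℝ => Complex.exp (Complex.I * ω * s) *
      (f t * Complex.exp (-(Complex.I * t * ω)))) s]
  refine integral_congr_ae (Eventually.of_forall fun t => ?_)
  simp only
  rw [mul_left_comm, ← Complex.exp_add]
  congr 2
  push_cast
  ring

/-- The pointwise product of two Schwartz functions. -/
def schwartzMul (f g : 𝓢(ℝ, ℂ)) : 𝓢(ℝ, ℂ) :=
  SchwartzMap.pairing (ContinuousLinearMap.mul ℂ ℂ) f g

theorem schwartzMul_apply (f g : 𝓢(ℝ, ℂ)) (x : ℝ) : schwartzMul f g x = f x * g x := rfl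

/-- The multiplication formula combined with the modulation produced by a translation. It serves
twice: for autocorrelations of test functions and for the convolution with the memory kernel. -/
theorem integral_translate_mul_schwartzFourier (f g : 𝓢(ℝ, ℂ)) (s : ℝ) :
    ∫ t, f (t + s) * schwartzFourier g t
      = schwartzFourier (schwartzMul (schwartzFourier f) g) (-s) := by
  simp only [schwartzFourier_apply g]
  rw [integral_mul_integral_exp_swap (f := fun t => f (t + s)) (f.integrable.comp_add_right s)
    g.integrable, schwartzFourier_apply]
  refine integral_congr_ae (Eventually.of_forall fun ω => ?_)
  simp only [integral_comp_add_mul_exp, schwartzMul_apply, ← schwartzFourier_apply]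
  rw [mul_assoc, mul_comm]
  congr 2
  push_cast
  ring

theorem exists_norm_le_inv_one_add_sq (f : 𝓢(ℝ, ℂ)) :
    ∃ C : ℝ, 0 ≤ C ∧ ∀ t, ‖f t‖ ≤ C * (1 + t ^ 2)⁻¹ := by
  obtain ⟨C0, h0, hC0⟩ := f.decay 0 0
  obtain ⟨C2, h2, hC2⟩ := f.decay 2 0
  refine ⟨C0 + C2, by positivity, fun t => ?_⟩
  have e0 := hC0 t
  have e2 := hC2 t
  simp only [norm_iteratedFDeriv_zero, pow_zero, one_mul, Real.norm_eq_abs, sq_abs] at e0 e2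
  rw [← div_eq_mul_inv, le_div_iff₀ (by positivity)]
  linarith

/-- Peetre's inequality. -/
theorem inv_one_add_sq_add_le (s t : ℝ) :
    (1 + (t + s) ^ 2)⁻¹ ≤ 2 * (1 + t ^ 2) * (1 + s ^ 2)⁻¹ := by
  rw [← div_eq_mul_inv, inv_eq_one_div, div_le_div_iff₀ (by positivity) (by positivity)]
  nlinarith [sq_nonneg (s + 2 * t), sq_nonneg (t * (t + s)), sq_nonneg t]

/-! ### Integrals of the kernel -/

namespace AdmissibleKernel

variable {K : ℝ → ℝ}

/-- Near the origin `K` is locally integrable, and far away it is only known to be bounded, so a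
weight is needed. This is what makes all pairings of `K` with Schwartz functions absolutely
convergent. -/
theorem integrable_mul_inv_one_add_sq (hK : AdmissibleKernel K) :
    Integrable fun t : ℝ => K t * (1 + t ^ 2)⁻¹ := by
  obtain ⟨A, hA0, hA, hpos⟩ := hK.exists_antitoneOn
  have hcont : Continuous fun t : ℝ => (1 + t ^ 2)⁻¹ :=
    Continuous.inv₀ (by fun_prop) fun t => by positivity
  have hin : IntegrableOn (fun t : ℝ => K t * (1 + t ^ 2)⁻¹) (Set.Icc (-A) A) :=
    (hK.locallyIntegrable.integrableOn_isCompact isCompact_Icc).mul_continuousOn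
      hcont.continuousOn isCompact_Icc
  have hout : IntegrableOn (fun t : ℝ => K t * (1 + t ^ 2)⁻¹) (Set.Icc (-A) A)ᶜ := by
    refine Integrable.mono' ((integrable_inv_one_add_sq.const_mul (K A)).integrableOn)
      (hK.locallyIntegrable.aestronglyMeasurable.mul hcont.aestronglyMeasurable).restrict
      ((ae_restrict_iff' measurableSet_Icc.compl).mpr (Eventually.of_forall fun t ht => ?_))
    have key : ∀ t, A ≤ t → |K t| ≤ K A := fun t ht => by
      rw [abs_of_nonneg (hpos t ht)]
      exact hA Set.self_mem_Ici ht ht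
    have h1 : |K t| ≤ K A := by
      rcases le_or_gt A t with h | h
      · exact key t h
      · have h2 : A ≤ -t := by
          by_contra h3
          exact ht ⟨by linarith, h.le⟩
        rw [← hK.symm t (by linarith)]
        exact key _ h2
    rw [norm_mul, Real.norm_eq_abs, Real.norm_of_nonneg (by positivity : (0 : ℝ) ≤ (1 + t ^ 2)⁻¹)]
    exact mul_le_mul_of_nonneg_right h1 (by positivity)
  have := hin.union hout
  rwa [Set.union_compl_self, integrableOn_univ] at this

theorem integrable_mul_of_norm_le (hK : AdmissibleKernel K) {f : ℝ → ℂ} (hf : Continuous f)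
    {C : ℝ} (hC : ∀ t, ‖f t‖ ≤ C * (1 + t ^ 2)⁻¹) : Integrable fun t => (K t : ℂ) * f t := by
  have hcont : Continuous fun t : ℝ => (1 + (t : ℂ) ^ 2) * f t := by fun_prop
  have h := (hK.integrable_mul_inv_one_add_sq.ofReal (𝕜 := ℂ)).mul_bdd (c := C)
    hcont.aestronglyMeasurable (Eventually.of_forall fun t => by
      rw [norm_mul]
      have h1 : ‖(1 + (t : ℂ) ^ 2)‖ = 1 + t ^ 2 := by
        have : (1 + (t : ℂ) ^ 2) = ((1 + t ^ 2 : ℝ) : ℂ) := by push_cast; ring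
        rw [this, Complex.norm_real, Real.norm_of_nonneg (by positivity)]
      rw [h1]
      calc _ ≤ (1 + t ^ 2) * (C * (1 + t ^ 2)⁻¹) :=
            mul_le_mul_of_nonneg_left (hC t) (by positivity)
        _ = C := by field_simp)
  refine h.congr (Eventually.of_forall fun t => ?_)
  have h2 : (1 + (t : ℂ) ^ 2) ≠ 0 := by
    have : (1 + (t : ℂ) ^ 2) = ((1 + t ^ 2 : ℝ) : ℂ) := by push_cast; ring
    rw [this]
    exact_mod_cast (by positivity : (1 + t ^ 2 : ℝ) ≠ 0)
  simp only [RCLike.ofReal_mul, Complex.coe_algebraMap]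
  push_cast
  field_simp

theorem integrable_mul_schwartz_neg (hK : AdmissibleKernel K) (f : 𝓢(ℝ, ℂ)) :
    Integrable fun t => (K t : ℂ) * f (-t) := by
  obtain ⟨C, _, hC⟩ := exists_norm_le_inv_one_add_sq f
  exact hK.integrable_mul_of_norm_le (by fun_prop) (C := C) fun t => by simpa using hC (-t)

/-- The half-line Fourier transform of the kernel against functions that vanish near the origin. -/
theorem integral_Ioi_mul_schwartzFourier_neg (hK : AdmissibleKernel K) (u : 𝓢(ℝ, ℂ)) {δ : ℝ}
    (hδ : 0 < δ) (hu : ∀ ω, |ω| < δ → u ω = 0) :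
    ∫ s in Set.Ioi (0 : ℝ), (K s : ℂ) * schwartzFourier u (-s)
      = ∫ ω, halfFourier K ω * u ω := by
  obtain ⟨A, B, hB, hbound⟩ := hK.exists_norm_halfTrunc_le
  have h1 := intervalIntegral_tendsto_integral_Ioi (0 : ℝ)
    (hK.integrable_mul_schwartz_neg (schwartzFourier u)).integrableOn tendsto_id
  have h2 : ∀ R : ℝ, 0 ≤ R → ∫ s in (0 : ℝ)..R, (K s : ℂ) * schwartzFourier u (-s)
      = ∫ ω, halfTrunc K R ω * u ω := by
    intro R hR
    have hint : Integrable ((Set.Ioc 0 R).indicator fun s => (K s : ℂ)) :=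
      ((intervalIntegrable_ofReal (hK.intervalIntegrable 0 R)).1).integrable_indicator
        measurableSet_Ioc
    have h := integral_mul_integral_exp_swap (hint.comp_neg) u.integrable
    have e1 : ∫ s in (0 : ℝ)..R, (K s : ℂ) * schwartzFourier u (-s)
        = ∫ t : ℝ, (Set.Ioc 0 R).indicator (fun s => (K s : ℂ)) (-t) *
          ∫ ω : ℝ, u ω * Complex.exp (-(Complex.I * ω * t)) := by
      rw [← integral_neg_eq_self, intervalIntegral.integral_of_le hR,
        ← integral_indicator measurableSet_Ioc]
      refine integral_congr_ae (Eventually.of_forall fun t => ?_)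
      simp only [neg_neg]
      rw [← schwartzFourier_apply]
      by_cases ht : t ∈ Set.Ioc 0 R <;> simp [ht]
    rw [e1, h]
    refine integral_congr_ae (Eventually.of_forall fun ω => ?_)
    simp only
    congr 1
    rw [← integral_neg_eq_self, halfTrunc, intervalIntegral.integral_of_le hR,
      ← integral_indicator measurableSet_Ioc]
    refine integral_congr_ae (Eventually.of_forall fun t => ?_)
    simp only [neg_neg]
    by_cases ht : t ∈ Set.Ioc 0 R
    · simp only [Set.indicator_of_mem ht]
      congr 2
      push_cast
      ring
    · simp [ht]
  -- The truncated transforms are bounded uniformly in `R` only away from `0`. The support condition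
  -- on `u` supplies the dominating function.
  have h3 : Tendsto (fun R : ℝ => ∫ ω, halfTrunc K R ω * u ω) atTop
      (𝓝 (∫ ω, halfFourier K ω * u ω)) := by
    refine tendsto_integral_filter_of_dominated_convergence
      (fun ω => B * (1 + δ⁻¹) * ‖u ω‖) ?_ ?_ (u.integrable.norm.const_mul _) ?_
    · exact Eventually.of_forall fun R =>
        ((hK.continuous_halfTrunc R).mul u.continuous).aestronglyMeasurable
    · filter_upwards [eventually_ge_atTop A] with R hR
      refine Eventually.of_forall fun ω => ?_
      rw [norm_mul]
      by_cases hω : |ω| < δ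
      · simp [hu ω hω]
      · have hω' := not_lt.mp hω
        have hω0 : ω ≠ 0 := fun h => by simp [h] at hω'; linarith
        refine mul_le_mul_of_nonneg_right ((hbound R ω hR hω0).trans ?_) (norm_nonneg _)
        gcongr
    · refine Eventually.of_forall fun ω => ?_
      by_cases hω : ω = 0
      · simp [hu ω (by simp [hω, hδ])]
      · exact (hK.tendsto_halfTrunc hω).mul_const _
  refine tendsto_nhds_unique (h1.congr' ?_) h3
  filter_upwards [eventually_ge_atTop 0] with R hR
  exact h2 R hR

end AdmissibleKernel

/-! ### Real test functions with prescribed even Fourier transform -/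

/-- A real Schwartz function, as a complex one. -/
def complexify (φ : 𝓢(ℝ, ℝ)) : 𝓢(ℝ, ℂ) := φ.postcompCLM Complex.ofRealCLM

theorem complexify_apply (φ : 𝓢(ℝ, ℝ)) (t : ℝ) : complexify φ t = φ t := rfl

/-- The real Schwartz function whose Fourier transform is the even function `ρ`. -/
def evenInverse (ρ : 𝓢(ℝ, ℝ)) : 𝓢(ℝ, ℝ) :=
  (((2 * Real.pi : ℂ)⁻¹) • schwartzFourier (complexify ρ)).postcompCLM Complex.reCLM

theorem two_pi_ne_zero_complex : (2 * Real.pi : ℂ) ≠ 0 := by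
  exact_mod_cast Real.two_pi_pos.ne'

theorem schwartzFourier_neg_of_even {f : 𝓢(ℝ, ℂ)} (hf : ∀ ω, f (-ω) = f ω) (x : ℝ) :
    schwartzFourier f (-x) = schwartzFourier f x := by
  rw [schwartzFourier_apply, schwartzFourier_apply, ← integral_neg_eq_self]
  refine integral_congr_ae (Eventually.of_forall fun t => ?_)
  simp only [hf]
  congr 2
  push_cast
  ring

theorem conj_schwartzFourier_complexify (ρ : 𝓢(ℝ, ℝ)) (x : ℝ) :
    conj (schwartzFourier (complexify ρ) x) = schwartzFourier (complexify ρ) (-x) := by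
  rw [schwartzFourier_apply, schwartzFourier_apply, ← integral_conj]
  refine integral_congr_ae (Eventually.of_forall fun t => ?_)
  simp [complexify_apply, ← Complex.exp_conj]

theorem AdmissibleKernel.integrable_halfFourier_mul {K : ℝ → ℝ} (hK : AdmissibleKernel K)
    (u : 𝓢(ℝ, ℂ)) {δ : ℝ} (hδ : 0 < δ) (hu : ∀ ω, |ω| < δ → u ω = 0) :
    Integrable fun ω => halfFourier K ω * u ω := by
  obtain ⟨B, hB, hbound⟩ := hK.exists_norm_halfFourier_le
  refine Integrable.mono' (u.integrable.norm.const_mul (B * (1 + δ⁻¹)))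
    (hK.measurable_halfFourier.aestronglyMeasurable.mul u.continuous.aestronglyMeasurable)
    (Eventually.of_forall fun ω => ?_)
  rw [norm_mul]
  by_cases hω : |ω| < δ
  · simp [hu ω hω]
  · have hω' := not_lt.mp hω
    have hω0 : ω ≠ 0 := fun h => by simp [h] at hω'; linarith
    refine mul_le_mul_of_nonneg_right ((hbound ω hω0).trans ?_) (norm_nonneg _)
    gcongr

section Even

variable {ρ : 𝓢(ℝ, ℝ)} (hρ : ∀ ω, ρ (-ω) = ρ ω)
include hρ

/-- For real `ρ`, conjugating the transform reflects its argument; for even `ρ`, reflection changes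
nothing. So the transform is real and taking real parts in `evenInverse` loses nothing. -/
theorem complexify_evenInverse :
    complexify (evenInverse ρ) = ((2 * Real.pi : ℂ)⁻¹) • schwartzFourier (complexify ρ) := by
  ext x
  rw [complexify_apply, evenInverse, SchwartzMap.postcompCLM_apply, Complex.reCLM_apply]
  refine Complex.conj_eq_iff_re.mp ?_
  rw [smul_apply, smul_eq_mul, map_mul, conj_schwartzFourier_complexify,
    schwartzFourier_neg_of_even (fun ω => by simp [complexify_apply, hρ])]
  have h2 : (2 * Real.pi : ℂ)⁻¹ = (((2 * Real.pi)⁻¹ : ℝ) : ℂ) := by push_cast; rfl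
  rw [h2, Complex.conj_ofReal]

theorem schwartzFourier_complexify_evenInverse :
    schwartzFourier (complexify (evenInverse ρ)) = complexify ρ := by
  ext x
  rw [complexify_evenInverse hρ, map_smul, smul_apply, schwartzFourier_schwartzFourier,
    smul_eq_mul, inv_mul_cancel_left₀ two_pi_ne_zero_complex, complexify_apply, complexify_apply, hρ]

/-- The autocorrelation of a function with transform `ρ` is the transform of `ρ² / (2π)`. -/
theorem integral_translate_evenInverse (s : ℝ) :
    ((∫ t, evenInverse ρ (t + s) * evenInverse ρ t : ℝ) : ℂ)
      = schwartzFourier ((2 * Real.pi : ℂ)⁻¹ • schwartzMul (complexify ρ) (complexify ρ)) (-s) := by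
  have h := integral_translate_mul_schwartzFourier (complexify (evenInverse ρ))
    ((2 * Real.pi : ℂ)⁻¹ • complexify ρ) s
  rw [map_smul, ← complexify_evenInverse hρ, schwartzFourier_complexify_evenInverse hρ] at h
  have h2 : schwartzMul (complexify ρ) ((2 * Real.pi : ℂ)⁻¹ • complexify ρ)
      = (2 * Real.pi : ℂ)⁻¹ • schwartzMul (complexify ρ) (complexify ρ) := by
    ext x
    simp only [schwartzMul_apply, smul_apply, smul_eq_mul]
    ring
  rw [← h2, ← h, ← integral_complex_ofReal]
  refine integral_congr_ae (Eventually.of_forall fun t => ?_)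
  simp [complexify_apply]

theorem integral_evenInverse_sq :
    ∫ t, evenInverse ρ t * evenInverse ρ t = (2 * Real.pi)⁻¹ * ∫ ω, ρ ω ^ 2 := by
  have h := integral_translate_evenInverse hρ 0
  simp only [add_zero, neg_zero, schwartzFourier_apply] at h
  apply Complex.ofReal_injective
  rw [h, ← integral_const_mul, ← integral_complex_ofReal]
  refine integral_congr_ae (Eventually.of_forall fun t => ?_)
  simp [schwartzMul_apply, complexify_apply, sq]

/-- Both `K` and the autocorrelation are even, so the integral over the line is twice the one over
the half-line. The latter passes to the frequency side because `ρ` vanishes near `0`. The factor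
`π⁻¹` is `2 · (2π)⁻¹`, and only the real part of the transform survives because the left side is
real. -/
theorem AdmissibleKernel.integral_mul_conv_evenInverse {K : ℝ → ℝ} (hK : AdmissibleKernel K)
    {δ : ℝ} (hδ : 0 < δ) (hu : ∀ ω, |ω| < δ → ρ ω = 0) :
    ∫ t, K t * conv (evenInverse ρ) (reflect (evenInverse ρ)) t
      = Real.pi⁻¹ * ∫ ω, (halfFourier K ω).re * ρ ω ^ 2 := by
  set u : 𝓢(ℝ, ℂ) := (2 * Real.pi : ℂ)⁻¹ • schwartzMul (complexify ρ) (complexify ρ) with hudef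
  have hu_apply : ∀ ω, u ω = (((2 * Real.pi)⁻¹ * ρ ω ^ 2 : ℝ) : ℂ) := fun ω => by
    simp [hudef, schwartzMul_apply, complexify_apply, sq]
  have hu_even : ∀ ω, u (-ω) = u ω := fun ω => by rw [hu_apply, hu_apply, hρ]
  have hg : ∀ t, (conv (evenInverse ρ) (reflect (evenInverse ρ)) t : ℂ)
      = schwartzFourier u (-t) := fun t => by
    rw [hudef, ← integral_translate_evenInverse hρ t, conv, convolution_def,
      ← integral_add_right_eq_self _ t]
    simp [reflect]
  have hint := hK.integrable_mul_schwartz_neg (schwartzFourier u)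
  have h1 : ((∫ t, K t * conv (evenInverse ρ) (reflect (evenInverse ρ)) t : ℝ) : ℂ)
      = ∫ t, (K t : ℂ) * schwartzFourier u (-t) := by
    rw [← integral_complex_ofReal]
    refine integral_congr_ae (Eventually.of_forall fun t => ?_)
    simp [hg]
  have h2 : ∫ t in Set.Iic (0 : ℝ), (K t : ℂ) * schwartzFourier u (-t)
      = ∫ t in Set.Ioi (0 : ℝ), (K t : ℂ) * schwartzFourier u (-t) := by
    have e := integral_comp_neg_Iic (0 : ℝ) fun t => (K t : ℂ) * schwartzFourier u (-t)
    rw [neg_zero] at e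
    rw [← e]
    refine setIntegral_congr_ae measurableSet_Iic ?_
    have h0 : ∀ᵐ t : ℝ, t ≠ 0 := by simp [ae_iff]
    filter_upwards [h0] with t ht _
    rw [hK.symm t ht, schwartzFourier_neg_of_even hu_even (-t)]
  have h3 := intervalIntegral.integral_Iic_add_Ioi hint.integrableOn hint.integrableOn (b := 0)
  rw [h2, hK.integral_Ioi_mul_schwartzFourier_neg u hδ fun ω hω => by simp [hu_apply, hu ω hω],
    ← h1] at h3
  have hGint : Integrable fun ω => halfFourier K ω * u ω :=
    hK.integrable_halfFourier_mul u hδ fun ω hω => by simp [hu_apply, hu ω hω]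
  have h4 := congrArg Complex.re h3
  have h5 : (∫ ω, halfFourier K ω * u ω).re = ∫ ω, (halfFourier K ω * u ω).re :=
    (integral_re hGint).symm
  rw [Complex.add_re, h5, Complex.ofReal_re] at h4
  rw [← h4, ← two_mul, ← integral_const_mul, ← integral_const_mul]
  refine integral_congr_ae (Eventually.of_forall fun ω => ?_)
  simp only [hu_apply, Complex.re_mul_ofReal]
  field_simp

end Even

/-! ### Functions that represent tempered distributions -/

theorem Represents.add {S T : 𝓢'(ℝ, ℂ)} {f g : ℝ → ℂ} (hS : Represents S f)
    (hT : Represents T g) : Represents (S + T) (fun t => f t + g t) := by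
  intro φ
  simp only [add_mul]
  refine ⟨(hS φ).1.add (hT φ).1, ?_⟩
  rw [integral_add (hS φ).1 (hT φ).1, ← (hS φ).2, ← (hT φ).2]
  rfl

theorem Represents.const_mul {T : 𝓢'(ℝ, ℂ)} {g : ℝ → ℂ} (hT : Represents T g) (c : ℂ) :
    Represents (c • T) (fun t => c * g t) := by
  intro φ
  simp only [mul_assoc]
  refine ⟨(hT φ).1.const_mul c, ?_⟩
  rw [integral_const_mul, ← (hT φ).2]
  rfl

theorem Represents.comp_neg {T : 𝓢'(ℝ, ℂ)} {g : ℝ → ℂ} (hT : Represents T g) :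
    Represents (PointwiseConvergenceCLM.precomp ℂ
      (SchwartzMap.compCLMOfContinuousLinearEquiv ℂ (ContinuousLinearEquiv.neg ℝ)) T)
      (fun t => g (-t)) := by
  intro φ
  have h := hT (SchwartzMap.compCLMOfContinuousLinearEquiv ℂ (ContinuousLinearEquiv.neg ℝ) φ)
  have h1 : ∀ t, SchwartzMap.compCLMOfContinuousLinearEquiv ℂ (ContinuousLinearEquiv.neg ℝ) φ t
      = φ (-t) := fun t => rfl
  simp only [h1] at h
  refine ⟨by simpa using h.1.comp_neg, ?_⟩
  rw [← integral_neg_eq_self]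
  simp only [neg_neg]
  exact h.2

theorem represents_schwartz (f : 𝓢(ℝ, ℂ)) :
    Represents (SchwartzMap.toTemperedDistributionCLM ℝ ℂ volume f) f := by
  intro φ
  refine ⟨(schwartzMul f φ).integrable, ?_⟩
  simp [mul_comm]

/-- The memory term is the reflection of `K⁺ * φ̃`, and `φ̃` is again a Schwartz function. Without
this check `ofFun` could silently take its default value `0`. -/
theorem isTempered_testFun {K : ℝ → ℝ} {lam β : ℝ}
    (h : ∀ φ : 𝓢(ℝ, ℝ), IsTempered fun t => (conv (plusPart K) φ t : ℂ)) (φ : 𝓢(ℝ, ℝ)) :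
    IsTempered (testFun 0 lam β K φ) := by
  obtain ⟨T, hT⟩ := h (SchwartzMap.compCLMOfContinuousLinearEquiv ℝ
    (ContinuousLinearEquiv.neg ℝ) φ)
  have h1 : testFun 0 lam β K φ = fun t => (lam : ℂ) * complexify φ t
      + (β : ℂ) * (conv (plusPart K) (SchwartzMap.compCLMOfContinuousLinearEquiv ℝ
        (ContinuousLinearEquiv.neg ℝ) φ) (-t) : ℂ) := by
    ext t
    simp only [testFun, complexify_apply, reflect]
    push_cast
    simp only [neg_zero, zero_mul, zero_add]
    rfl
  rw [h1]
  exact ⟨_, ((represents_schwartz (complexify φ)).const_mul lam).add (hT.comp_neg.const_mul β)⟩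

/-! ### The Fourier transform of the test functions of the equation -/

/-- Peetre's inequality moves the decay of `f (t + s)` onto `s`, where it tames `K`, at the price of
a factor `1 + t²` absorbed by `g`. -/
theorem AdmissibleKernel.integrable_prod_mul_translate {K : ℝ → ℝ} (hK : AdmissibleKernel K)
    (f g : 𝓢(ℝ, ℂ)) :
    Integrable (fun p : ℝ × ℝ => (plusPart K p.2 : ℂ) * f (p.1 + p.2) * g p.1)
      (volume.prod volume) := by
  obtain ⟨C, hC0, hC⟩ := exists_norm_le_inv_one_add_sq f
  have hg : Integrable fun t : ℝ => (1 + t ^ 2) * ‖g t‖ := by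
    have := (g.integrable_pow_mul volume 0).add (g.integrable_pow_mul volume 2)
    refine this.congr (Eventually.of_forall fun t => ?_)
    simp [add_mul]
  refine Integrable.mono' ((hg.mul_prod hK.integrable_mul_inv_one_add_sq.norm).const_mul (C * 2))
    ?_ (Eventually.of_forall fun p => ?_)
  · have h1 : AEStronglyMeasurable (plusPart K) :=
      hK.locallyIntegrable.aestronglyMeasurable.indicator measurableSet_Ici
    exact ((Complex.continuous_ofReal.comp_aestronglyMeasurable h1.comp_snd).mul
      (by fun_prop)).mul (by fun_prop)
  · rw [norm_mul, norm_mul, norm_mul, Complex.norm_real]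
    have h1 : ‖plusPart K p.2‖ ≤ ‖K p.2‖ := norm_indicator_le_norm_self _ _
    have h2 := (hC (p.1 + p.2)).trans
      (mul_le_mul_of_nonneg_left (inv_one_add_sq_add_le p.2 p.1) hC0)
    have h3 : ‖(1 + p.2 ^ 2 : ℝ)⁻¹‖ = (1 + p.2 ^ 2)⁻¹ := Real.norm_of_nonneg (by positivity)
    rw [h3]
    calc _ ≤ ‖K p.2‖ * (C * (2 * (1 + p.1 ^ 2) * (1 + p.2 ^ 2)⁻¹)) * ‖g p.1‖ := by gcongr
      _ = _ := by ring

theorem testFun_eq (K : ℝ → ℝ) (lam β : ℝ) (φ : 𝓢(ℝ, ℝ)) (t : ℝ) :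
    testFun 0 lam β K φ t
      = lam * φ t + β * ∫ s, (plusPart K s : ℂ) * complexify φ (t + s) := by
  have h : (∫ s, (plusPart K s : ℂ) * complexify φ (t + s))
      = ((∫ s, plusPart K s * φ (t + s) : ℝ) : ℂ) := by
    rw [← integral_complex_ofReal]
    simp [complexify_apply]
  rw [h, testFun, reflect, conv, convolution_def]
  simp [reflect, add_comm]

/-- The memory term at `t` is `∫ K⁺(s) φ(t + s) ds`. After Fubini, its pairing with `θ̂` becomes the
integral of `K(s)` against `û(-s)` over the half-line, with `u = φ̂ θ`. As `u` vanishes near `0`,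
this equals the pairing of `u` with the half-line transform of `K`. -/
theorem AdmissibleKernel.represents_distribFourier_testFun {K : ℝ → ℝ} (hK : AdmissibleKernel K)
    {lam β : ℝ} {φ : 𝓢(ℝ, ℝ)} (hT : IsTempered (testFun 0 lam β K φ)) {δ : ℝ}
    (hδ : 0 < δ) (hφ : ∀ ω, |ω| < δ → schwartzFourier (complexify φ) ω = 0) :
    Represents (distribFourier (ofFun (testFun 0 lam β K φ)))
      (fun ω => (lam + β * halfFourier K ω) * schwartzFourier (complexify φ) ω) := by
  intro θ
  set f := complexify φ with hf
  set u := schwartzMul (schwartzFourier f) θ with hu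
  have hu0 : ∀ ω, |ω| < δ → u ω = 0 := fun ω hω => by rw [hu, schwartzMul_apply, hφ ω hω, zero_mul]
  have hGu := hK.integrable_halfFourier_mul u hδ hu0
  have hsplit : (fun ω => (lam + β * halfFourier K ω) * schwartzFourier f ω * θ ω)
      = fun ω => lam * u ω + β * (halfFourier K ω * u ω) := by
    ext ω
    simp only [hu, schwartzMul_apply]
    ring
  rw [hsplit]
  refine ⟨(u.integrable.const_mul _).add (hGu.const_mul _), ?_⟩
  rw [integral_add (u.integrable.const_mul _) (hGu.const_mul _), integral_const_mul,
    integral_const_mul, distribFourier_apply, (represents_ofFun hT (schwartzFourier θ)).2]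
  have hprod := hK.integrable_prod_mul_translate f (schwartzFourier θ)
  have hi1 : Integrable fun t => f t * schwartzFourier θ t :=
    (schwartzMul f (schwartzFourier θ)).integrable
  have hi2 : Integrable fun t =>
      ∫ s, (plusPart K s : ℂ) * f (t + s) * schwartzFourier θ t := hprod.integral_prod_left
  have e1 : (fun t => testFun 0 lam β K φ t * schwartzFourier θ t)
      = fun t => lam * (f t * schwartzFourier θ t)
        + β * ∫ s, (plusPart K s : ℂ) * f (t + s) * schwartzFourier θ t := by
    ext t
    rw [testFun_eq, integral_mul_const, hf, complexify_apply]
    ring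
  rw [e1, integral_add (hi1.const_mul _) (hi2.const_mul _), integral_const_mul, integral_const_mul]
  have h0 : ∫ t, f t * schwartzFourier θ t = ∫ ω, u ω := by
    have := integral_translate_mul_schwartzFourier f θ 0
    rw [neg_zero, schwartzFourier_apply] at this
    simpa using this
  have h1 : ∫ t, ∫ s, (plusPart K s : ℂ) * f (t + s) * schwartzFourier θ t
      = ∫ ω, halfFourier K ω * u ω := by
    rw [integral_integral_swap hprod, ← hK.integral_Ioi_mul_schwartzFourier_neg u hδ hu0,
      ← integral_Ici_eq_integral_Ioi, ← integral_indicator measurableSet_Ici]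
    refine integral_congr_ae (Eventually.of_forall fun s => ?_)
    simp only [mul_assoc]
    rw [integral_const_mul, integral_translate_mul_schwartzFourier]
    by_cases hs : s ∈ Set.Ici (0 : ℝ) <;> simp [plusPart, hs, hu]
  rw [h0, h1]

/-! ### Comparison of measures through smooth functions -/

theorem exists_contDiff_indicator_between {A U : Set ℝ} (hA : IsClosed A) (hU : IsOpen U)
    (hAU : A ⊆ U) : ∃ f : ℝ → ℝ, ContDiff ℝ (⊤ : ℕ∞) f ∧ (∀ x, 0 ≤ f x ∧ f x ≤ 1) ∧
      (∀ x ∉ U, f x = 0) ∧ ∀ x ∈ A, f x = 1 := by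
  obtain ⟨f, hf, hr, hs, h1⟩ := exists_contMDiff_support_eq_eq_one_iff (n := (⊤ : ℕ∞))
    (modelWithCornersSelf ℝ ℝ) hU hA hAU
  refine ⟨f, hf.contDiff, fun x => hr ⟨x, rfl⟩, fun x hx => ?_, fun x hx => (h1 x).mp hx⟩
  rw [← hs] at hx
  simpa using hx

/-- Regularity of finite Borel measures: compact sets are compared through smooth cutoffs and outer
regularity of `μ₂`, general sets through inner regularity of `μ₁`. Squares appear because the
spectral estimates are quadratic in the test function. -/
theorem measure_le_of_forall_lintegral_contDiff_le {μ₁ μ₂ : Measure ℝ} [IsFiniteMeasure μ₁]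
    [IsFiniteMeasure μ₂] {A U : Set ℝ} (hA : IsCompact A) (hU : IsOpen U) (hAU : A ⊆ U)
    (hμ : μ₁ Aᶜ = 0)
    (h : ∀ χ : ℝ → ℝ, ContDiff ℝ (⊤ : ℕ∞) χ → (∀ x, 0 ≤ χ x ∧ χ x ≤ 1) → (∀ x ∉ U, χ x = 0) →
      ∫⁻ x, ENNReal.ofReal (χ x ^ 2) ∂μ₁ ≤ ∫⁻ x, ENNReal.ofReal (χ x ^ 2) ∂μ₂) : μ₁ ≤ μ₂ := by
  have hcompact : ∀ C : Set ℝ, IsCompact C → C ⊆ U → μ₁ C ≤ μ₂ C := by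
    intro C hC hCU
    rw [C.measure_eq_iInf_isOpen μ₂]
    refine le_iInf₂ fun V hCV => le_iInf fun hV => ?_
    obtain ⟨χ, hχ, h01, h0, h1⟩ := exists_contDiff_indicator_between hC.isClosed (hU.inter hV)
      (Set.subset_inter hCU hCV)
    calc μ₁ C = ∫⁻ x, C.indicator 1 x ∂μ₁ := by rw [lintegral_indicator_one hC.measurableSet]
      _ ≤ ∫⁻ x, ENNReal.ofReal (χ x ^ 2) ∂μ₁ := by
        refine lintegral_mono fun x => ?_
        by_cases hx : x ∈ C
        · simp [hx, h1 x hx]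
        · simp [hx]
      _ ≤ ∫⁻ x, ENNReal.ofReal (χ x ^ 2) ∂μ₂ :=
        h χ hχ h01 fun x hx => h0 x fun hx' => hx hx'.1
      _ ≤ ∫⁻ x, V.indicator 1 x ∂μ₂ := by
        refine lintegral_mono fun x => ?_
        by_cases hx : x ∈ V
        · simp only [Set.indicator_of_mem hx, Pi.one_apply]
          exact ENNReal.ofReal_le_one.mpr (pow_le_one₀ (h01 x).1 (h01 x).2)
        · simp [h0 x fun hx' => hx hx'.2]
      _ = μ₂ V := lintegral_indicator_one hV.measurableSet
  refine Measure.le_iff.mpr fun E hE => ?_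
  rw [hE.measure_eq_iSup_isCompact_of_ne_top (measure_ne_top μ₁ E)]
  refine iSup₂_le fun C hCE => iSup_le fun hC => ?_
  calc μ₁ C ≤ μ₁ (C ∩ A) + μ₁ (C \ A) := measure_le_inter_add_sdiff _ _ _
    _ = μ₁ (C ∩ A) := by
      rw [measure_mono_null (fun x hx => hx.2 : C \ A ⊆ Aᶜ) hμ, add_zero]
    _ ≤ μ₂ (C ∩ A) := hcompact _ (hC.inter hA) (Set.inter_subset_right.trans hAU)
    _ ≤ μ₂ E := measure_mono (Set.inter_subset_left.trans hCE)

/-! ### Norms in `L²` -/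

theorem Lp_integral_mul_conj {Ω : Type*} [MeasurableSpace Ω] {P : Measure Ω} (f : Lp ℂ 2 P) :
    ∫ x, f x * conj (f x) ∂P = ((‖f‖ ^ 2 : ℝ) : ℂ) := by
  have h := inner_self_eq_norm_sq_to_K (𝕜 := ℂ) f
  rw [L2.inner_def] at h
  rw [Complex.ofReal_pow]
  exact h

theorem Lp_integral_norm_sq {α : Type*} [MeasurableSpace α] {μ : Measure α} (f : Lp ℂ 2 μ) :
    ∫ x, ‖f x‖ ^ 2 ∂μ = ‖f‖ ^ 2 := by
  have h := Lp_integral_mul_conj f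
  simp only [Complex.mul_conj, Complex.normSq_eq_norm_sq] at h
  rw [integral_complex_ofReal] at h
  exact_mod_cast h

/-- The stochastic integral is an isometry, and absolute continuity makes the value independent of
the representative of the transform. -/
theorem GaussianRandomMeasure.norm_sq_op {ν : Measure ℝ} {Ω : Type*} [MeasurableSpace Ω]
    {P : Measure Ω} (ξ : GaussianRandomMeasure ν P) (hν : ν ≪ volume) {T : 𝓢'(ℝ, ℂ)}
    {h : ℝ → ℂ} (h1 : Represents (distribFourier T) h) (h2 : MemLp h 2 ν) :
    ‖ξ.op T‖ ^ 2 = ∫ ω, ‖h ω‖ ^ 2 ∂ν := by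
  have hc : MemLp (fun ω => conj (h ω)) 2 ν := h2.star
  rw [ξ.op_eq hν h1 h2, GaussianRandomMeasure.integral, dif_pos hc, norm_integralL2,
    ← Lp_integral_norm_sq]
  refine integral_congr_ae (hc.coeFn_toLp.mono fun ω hω => ?_)
  simp [hω]

/-! ### The symbol of the equation -/

/-- The Fourier symbol `lam + β ∫₀^∞ K (t) e^{iωt} dt` of the equation without mass. -/
def symbol (K : ℝ → ℝ) (lam β ω : ℝ) : ℂ := lam + β * halfFourier K ω

section Symbol

variable {K : ℝ → ℝ} {lam β : ℝ}

theorem re_symbol (ω : ℝ) : (symbol K lam β ω).re = lam + β * (halfFourier K ω).re := by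
  simp [symbol]

/-- Ellipticity: the memory contributes a nonnegative real part, so the symbol stays away from zero.
At `ω = 0` this rests on the convention `halfFourier K 0 = 0`. -/
theorem le_re_symbol (hK : AdmissibleKernel K) (hβ : 0 ≤ β) (ω : ℝ) :
    lam ≤ (symbol K lam β ω).re := by
  rw [re_symbol]
  nlinarith [hK.re_halfFourier_nonneg ω]

theorem re_symbol_neg (hK : AdmissibleKernel K) (ω : ℝ) :
    (symbol K lam β (-ω)).re = (symbol K lam β ω).re := by
  rw [re_symbol, re_symbol, hK.halfFourier_neg, Complex.conj_re]

theorem measurable_symbol (hK : AdmissibleKernel K) : Measurable (symbol K lam β) :=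
  measurable_const.add (measurable_const.mul hK.measurable_halfFourier)

theorem exists_norm_symbol_le (hK : AdmissibleKernel K) (lam β : ℝ) {δ : ℝ} (hδ : 0 < δ) :
    ∃ M : ℝ, 0 ≤ M ∧ ∀ ω, δ ≤ |ω| → ‖symbol K lam β ω‖ ≤ M := by
  obtain ⟨B, hB, h⟩ := hK.exists_norm_halfFourier_le
  refine ⟨|lam| + |β| * (B * (1 + δ⁻¹)), by positivity, fun ω hω => ?_⟩
  have hω0 : ω ≠ 0 := fun h => by simp [h] at hω; linarith
  refine (norm_add_le _ _).trans ?_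
  rw [norm_mul, Complex.norm_real, Complex.norm_real, Real.norm_eq_abs, Real.norm_eq_abs]
  gcongr
  exact (h ω hω0).trans (by gcongr)

end Symbol

/-- The weight in the growth condition is bounded below on bounded sets. -/
theorem IsSpectralMeasure.isFiniteMeasureOnCompacts {ν : Measure ℝ} (hν : IsSpectralMeasure ν) :
    IsFiniteMeasureOnCompacts ν := by
  obtain ⟨k, hk⟩ := hν.growth
  refine ⟨fun C hC => ?_⟩
  obtain ⟨R, hR⟩ := hC.isBounded.exists_norm_le
  have hpos : 0 < ((1 + R ^ 2) ^ k)⁻¹ := by positivity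
  have h1 : ENNReal.ofReal (((1 + R ^ 2) ^ k)⁻¹) * ν C
      ≤ ∫⁻ x : ℝ, ENNReal.ofReal (((1 + x ^ 2) ^ k)⁻¹) ∂ν := by
    rw [← setLIntegral_const]
    refine (setLIntegral_mono' hC.measurableSet fun x hx => ?_).trans (setLIntegral_le_lintegral _ _)
    refine ENNReal.ofReal_le_ofReal ?_
    have h2 : x ^ 2 ≤ R ^ 2 := by
      have h3 := hR x hx
      rw [← sq_abs x]
      exact pow_le_pow_left₀ (abs_nonneg x) h3 2
    gcongr
  by_contra hC'
  rw [not_lt, top_le_iff] at hC'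
  rw [hC', ENNReal.mul_top (by simpa using hpos)] at h1
  exact absurd hk (not_lt.mpr h1)

/-! ### The spectral estimates -/

/-- Even real test functions on the frequency side, supported in `δ ≤ |ω| ≤ R`. -/
structure IsAnnular (ρ : 𝓢(ℝ, ℝ)) (δ R : ℝ) : Prop where
  pos : 0 < δ
  even : ∀ ω, ρ (-ω) = ρ ω
  zero_of_lt : ∀ ω, |ω| < δ → ρ ω = 0
  zero_of_gt : ∀ ω, R < |ω| → ρ ω = 0

section Spectral

variable {Ω : Type*} [MeasurableSpace Ω] {P : Measure Ω} {K : ℝ → ℝ} {lam β : ℝ}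
  {W F : StationaryRandomDistribution P} {ν : Measure ℝ} {ξ : GaussianRandomMeasure ν P}
  {ρ : 𝓢(ℝ, ℝ)} {δ R : ℝ}

theorem IsAnnular.memLp (hρ : IsAnnular ρ δ R) (hK : AdmissibleKernel K)
    (hν : IsSpectralMeasure ν) : MemLp (fun ω => symbol K lam β ω * complexify ρ ω) 2 ν := by
  have := hν.isFiniteMeasureOnCompacts
  obtain ⟨M, hM, hz⟩ := exists_norm_symbol_le hK lam β hρ.pos
  obtain ⟨C, hC0, hC⟩ := exists_norm_le_inv_one_add_sq (complexify ρ)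
  have hmeas : AEStronglyMeasurable (fun ω => symbol K lam β ω * complexify ρ ω) ν :=
    (measurable_symbol hK).aestronglyMeasurable.mul
      (complexify ρ).continuous.aestronglyMeasurable
  have hind : (fun ω => symbol K lam β ω * complexify ρ ω)
      = (Set.Icc (-R) R).indicator fun ω => symbol K lam β ω * complexify ρ ω := by
    ext ω
    by_cases hω : ω ∈ Set.Icc (-R) R
    · rw [Set.indicator_of_mem hω]
    · rw [Set.indicator_of_notMem hω, complexify_apply, hρ.zero_of_gt ω, Complex.ofReal_zero,
        mul_zero]
      rw [← not_le, abs_le]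
      exact hω
  rw [hind, memLp_indicator_iff_restrict measurableSet_Icc]
  have hfin : IsFiniteMeasure (ν.restrict (Set.Icc (-R) R)) :=
    ⟨by rw [Measure.restrict_apply_univ]; exact isCompact_Icc.measure_lt_top⟩
  refine MemLp.of_bound hmeas.restrict (M * C) (Eventually.of_forall fun ω => ?_)
  rw [norm_mul]
  by_cases hω : |ω| < δ
  · rw [complexify_apply, hρ.zero_of_lt ω hω]
    simp only [Complex.ofReal_zero, norm_zero, mul_zero]
    positivity
  · refine mul_le_mul (hz ω (not_lt.mp hω)) ((hC ω).trans ?_) (norm_nonneg _) hM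
    exact mul_le_of_le_one_right hC0 (inv_le_one_of_one_le₀ (by nlinarith [sq_nonneg ω]))

/-- The noise tested against the function with Fourier transform `ρ`. -/
theorem norm_sq_noise (hK : AdmissibleKernel K) (hV : IsWeakSolution 0 lam β K W F ξ)
    (hρ : IsAnnular ρ δ R) :
    ‖Real.sqrt (2 * lam) • W.toLin (evenInverse ρ) + Real.sqrt β • F.toLin (evenInverse ρ)‖ ^ 2
      = ∫ ω, ‖symbol K lam β ω‖ ^ 2 * ρ ω ^ 2 ∂ν := by
  have hT := isTempered_testFun (lam := lam) (β := β) (fun φ => (hV.mem_dom φ).1) (evenInverse ρ)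
  have hφ := schwartzFourier_complexify_evenInverse hρ.even
  have hrep := hK.represents_distribFourier_testFun hT hρ.pos fun ω hω => by
    rw [hφ, complexify_apply, hρ.zero_of_lt ω hω, Complex.ofReal_zero]
  rw [hφ] at hrep
  have h1 := ξ.norm_sq_op hV.isSpectralMeasure.absolutelyContinuous hrep
    (hρ.memLp hK hV.isSpectralMeasure)
  have h2 := hV.covariance (evenInverse ρ) (evenInverse ρ)
  rw [Lp_integral_mul_conj, Lp_integral_mul_conj] at h2
  rw [← Complex.ofReal_injective h2, h1]
  refine integral_congr_ae (Eventually.of_forall fun ω => ?_)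
  simp only [norm_mul, mul_pow, complexify_apply, Complex.norm_real, Real.norm_eq_abs, sq_abs]
  rfl

theorem norm_sq_whiteNoise (hW : IsWhiteNoise W) (hρ : IsAnnular ρ δ R) :
    ‖W.toLin (evenInverse ρ)‖ ^ 2 = (2 * Real.pi)⁻¹ * ∫ ω, ρ ω ^ 2 := by
  have h := hW (evenInverse ρ) (evenInverse ρ)
  rw [Lp_integral_mul_conj, integral_evenInverse_sq hρ.even] at h
  exact Complex.ofReal_injective h

theorem norm_sq_colouredNoise (hK : AdmissibleKernel K) (hF : HasCovarianceKernel F K)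
    (hρ : IsAnnular ρ δ R) :
    ‖F.toLin (evenInverse ρ)‖ ^ 2 = Real.pi⁻¹ * ∫ ω, (halfFourier K ω).re * ρ ω ^ 2 := by
  have h := hF (evenInverse ρ) (evenInverse ρ)
  rw [Lp_integral_mul_conj, hK.integral_mul_conv_evenInverse hρ.even hρ.pos hρ.zero_of_lt] at h
  exact Complex.ofReal_injective h

theorem integrable_schwartz_sq (ρ : 𝓢(ℝ, ℝ)) : Integrable fun ω => ρ ω ^ 2 := by
  have := (schwartzMul (complexify ρ) (complexify ρ)).integrable (μ := volume)
  refine this.re.congr (Eventually.of_forall fun ω => ?_)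
  simp [schwartzMul_apply, complexify_apply, sq]

theorem IsAnnular.integrable_re_halfFourier (hρ : IsAnnular ρ δ R) (hK : AdmissibleKernel K) :
    Integrable fun ω => (halfFourier K ω).re * ρ ω ^ 2 := by
  have := hK.integrable_halfFourier_mul (schwartzMul (complexify ρ) (complexify ρ)) hρ.pos
    fun ω hω => by rw [schwartzMul_apply, complexify_apply, hρ.zero_of_lt ω hω]; simp
  refine this.re.congr (Eventually.of_forall fun ω => ?_)
  have h1 : schwartzMul (complexify ρ) (complexify ρ) ω = ((ρ ω ^ 2 : ℝ) : ℂ) := by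
    simp [schwartzMul_apply, complexify_apply, sq]
  simp only [h1]
  exact Complex.re_mul_ofReal _ _

theorem IsAnnular.integrable_re_symbol (hρ : IsAnnular ρ δ R) (hK : AdmissibleKernel K) :
    Integrable fun ω => (symbol K lam β ω).re * ρ ω ^ 2 := by
  have := ((integrable_schwartz_sq ρ).const_mul lam).add
    ((hρ.integrable_re_halfFourier hK).const_mul β)
  refine this.congr (Eventually.of_forall fun ω => ?_)
  simp only [re_symbol, Pi.add_apply]
  ring

/-- Upper bound for the spectral measure, in integrated form. -/
theorem integral_symbol_sq_le (hK : AdmissibleKernel K) (hlam : 0 < lam) (hβ : 0 ≤ β)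
    (hW : IsWhiteNoise W) (hF : HasCovarianceKernel F K)
    (hV : IsWeakSolution 0 lam β K W F ξ) (hρ : IsAnnular ρ δ R) :
    ∫ ω, ‖symbol K lam β ω‖ ^ 2 * ρ ω ^ 2 ∂ν
      ≤ 2 / Real.pi * ∫ ω, (symbol K lam β ω).re * ρ ω ^ 2 := by
  have hsplit : ∫ ω, (symbol K lam β ω).re * ρ ω ^ 2
      = lam * (∫ ω, ρ ω ^ 2) + β * ∫ ω, (halfFourier K ω).re * ρ ω ^ 2 := by
    rw [← integral_const_mul, ← integral_const_mul, ← integral_add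
      ((integrable_schwartz_sq ρ).const_mul lam) ((hρ.integrable_re_halfFourier hK).const_mul β)]
    refine integral_congr_ae (Eventually.of_forall fun ω => ?_)
    simp only [re_symbol]
    ring
  rw [← norm_sq_noise hK hV hρ, hsplit]
  -- The two noises may be correlated, so the cross term is controlled only by the triangle
  -- inequality, at the cost of a factor `2`.
  have h1 := norm_add_le (Real.sqrt (2 * lam) • W.toLin (evenInverse ρ))
    (Real.sqrt β • F.toLin (evenInverse ρ))
  have hw : ‖Real.sqrt (2 * lam) • W.toLin (evenInverse ρ)‖ ^ 2
      = 2 * lam * ((2 * Real.pi)⁻¹ * ∫ ω, ρ ω ^ 2) := by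
    rw [norm_smul, mul_pow, norm_sq_whiteNoise hW hρ, Real.norm_eq_abs, sq_abs,
      Real.sq_sqrt (by positivity)]
  have hf : ‖Real.sqrt β • F.toLin (evenInverse ρ)‖ ^ 2
      = β * (Real.pi⁻¹ * ∫ ω, (halfFourier K ω).re * ρ ω ^ 2) := by
    rw [norm_smul, mul_pow, norm_sq_colouredNoise hK hF hρ, Real.norm_eq_abs, sq_abs,
      Real.sq_sqrt hβ]
  set a := ‖Real.sqrt (2 * lam) • W.toLin (evenInverse ρ)‖
  set b := ‖Real.sqrt β • F.toLin (evenInverse ρ)‖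
  calc _ ≤ (a + b) ^ 2 := pow_le_pow_left₀ (norm_nonneg _) h1 2
    _ ≤ 2 * (a ^ 2 + b ^ 2) := by nlinarith [sq_nonneg (a - b)]
    _ = _ := by rw [hw, hf]; field_simp

/-- Lower bound for the spectral measure, in integrated form, at frequencies where the memory
is negligible. -/
theorem le_integral_symbol_sq (hK : AdmissibleKernel K) (hlam : 0 < lam) (hβ : 0 ≤ β)
    (hW : IsWhiteNoise W) (hF : HasCovarianceKernel F K)
    (hV : IsWeakSolution 0 lam β K W F ξ) (hρ : IsAnnular ρ δ R)
    (hδ : ∀ ω, δ ≤ |ω| → β * (halfFourier K ω).re ≤ lam / 4) :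
    lam / (4 * Real.pi) * ∫ ω, ρ ω ^ 2 ≤ ∫ ω, ‖symbol K lam β ω‖ ^ 2 * ρ ω ^ 2 ∂ν := by
  rw [← norm_sq_noise hK hV hρ]
  have hw : ‖Real.sqrt (2 * lam) • W.toLin (evenInverse ρ)‖ ^ 2
      = 2 * lam * ((2 * Real.pi)⁻¹ * ∫ ω, ρ ω ^ 2) := by
    rw [norm_smul, mul_pow, norm_sq_whiteNoise hW hρ, Real.norm_eq_abs, sq_abs,
      Real.sq_sqrt (by positivity)]
  have hf : ‖Real.sqrt β • F.toLin (evenInverse ρ)‖ ^ 2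
      ≤ lam / 4 * (Real.pi⁻¹ * ∫ ω, ρ ω ^ 2) := by
    rw [norm_smul, mul_pow, norm_sq_colouredNoise hK hF hρ, Real.norm_eq_abs, sq_abs,
      Real.sq_sqrt hβ]
    have h1 : β * ∫ ω, (halfFourier K ω).re * ρ ω ^ 2 ≤ lam / 4 * ∫ ω, ρ ω ^ 2 := by
      rw [← integral_const_mul, ← integral_const_mul]
      refine integral_mono ((hρ.integrable_re_halfFourier hK).const_mul β)
        ((integrable_schwartz_sq ρ).const_mul _) fun ω => ?_
      simp only
      rw [← mul_assoc]
      by_cases hω : |ω| < δ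
      · simp [hρ.zero_of_lt ω hω]
      · exact mul_le_mul_of_nonneg_right (hδ ω (not_lt.mp hω)) (sq_nonneg _)
    have hpi : 0 < Real.pi⁻¹ := by positivity
    nlinarith
  have h1 := norm_le_add_norm_add (Real.sqrt (2 * lam) • W.toLin (evenInverse ρ))
    (Real.sqrt β • F.toLin (evenInverse ρ))
  set a := ‖Real.sqrt (2 * lam) • W.toLin (evenInverse ρ)‖
  set b := ‖Real.sqrt β • F.toLin (evenInverse ρ)‖
  have ha : 0 ≤ a := norm_nonneg _
  have hb : 0 ≤ b := norm_nonneg _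
  -- The threshold `lam / 4` is chosen for this: `a²` is `(lam/π) ∫ ρ²` and `b²` is at most a
  -- quarter of it, so even fully opposed noises leave a norm of at least `a / 2`.
  have hba : b ≤ a / 2 := by
    refine abs_le_of_sq_le_sq' ?_ (by positivity) |>.2
    refine hf.trans (le_of_eq ?_)
    rw [div_pow, hw]
    field_simp
    ring
  calc lam / (4 * Real.pi) * ∫ ω, ρ ω ^ 2 = (a / 2) ^ 2 := by
        rw [div_pow, hw]
        field_simp
        ring
    _ ≤ _ := pow_le_pow_left₀ (by positivity) (by linarith) 2

end Spectral

/-! ### The spectral measure is bounded by a multiple of the Lebesgue measure -/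

/-- `χ (ω) + χ (-ω)`, as a Schwartz function. -/
def evenPart (χ : 𝓢(ℝ, ℝ)) : 𝓢(ℝ, ℝ) :=
  χ + SchwartzMap.compCLMOfContinuousLinearEquiv ℝ (ContinuousLinearEquiv.neg ℝ) χ

theorem evenPart_apply (χ : 𝓢(ℝ, ℝ)) (ω : ℝ) : evenPart χ ω = χ ω + χ (-ω) := rfl

theorem isAnnular_evenPart {χ : 𝓢(ℝ, ℝ)} {δ R : ℝ} (hδ : 0 < δ)
    (h : ∀ ω, |ω| < δ ∨ R < |ω| → χ ω = 0) : IsAnnular (evenPart χ) δ R where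
  pos := hδ
  even ω := by rw [evenPart_apply, evenPart_apply, neg_neg, add_comm]
  zero_of_lt ω hω := by
    rw [evenPart_apply, h ω (Or.inl hω), h (-ω) (Or.inl (by rwa [abs_neg])), add_zero]
  zero_of_gt ω hω := by
    rw [evenPart_apply, h ω (Or.inr hω), h (-ω) (Or.inr (by rwa [abs_neg])), add_zero]

/-- The open annulus `δ < |ω| < R`. -/
def annulus (δ R : ℝ) : Set ℝ := {ω | δ < |ω| ∧ |ω| < R}

/-- The closed annulus `δ ≤ |ω| ≤ R`. -/
def closedAnnulus (δ R : ℝ) : Set ℝ := {ω | δ ≤ |ω| ∧ |ω| ≤ R}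

theorem isOpen_annulus (δ R : ℝ) : IsOpen (annulus δ R) :=
  (isOpen_lt continuous_const continuous_abs).inter (isOpen_lt continuous_abs continuous_const)

theorem isCompact_closedAnnulus (δ R : ℝ) : IsCompact (closedAnnulus δ R) := by
  refine (isCompact_Icc (a := -R) (b := R)).of_isClosed_subset
    ((isClosed_le continuous_const continuous_abs).inter
      (isClosed_le continuous_abs continuous_const)) fun ω hω => ?_
  exact abs_le.mp hω.2

theorem annulus_subset_closedAnnulus (δ R : ℝ) : annulus δ R ⊆ closedAnnulus δ R :=
  fun _ h => ⟨h.1.le, h.2.le⟩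

/-- A smooth function that vanishes outside of an annulus, as a Schwartz function. -/
theorem exists_schwartz_of_contDiff {χ : ℝ → ℝ} {δ R : ℝ} (hχ : ContDiff ℝ (⊤ : ℕ∞) χ)
    (h0 : ∀ ω ∉ annulus δ R, χ ω = 0) : ∃ f : 𝓢(ℝ, ℝ), ∀ ω, f ω = χ ω := by
  have hc : HasCompactSupport χ := HasCompactSupport.of_support_subset_isCompact
    (isCompact_closedAnnulus δ R) fun ω hω => annulus_subset_closedAnnulus δ R
      (by by_contra h; exact hω (h0 ω h))
  exact ⟨hc.toSchwartzMap hχ, fun ω => rfl⟩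

section Spectral

variable {Ω : Type*} [MeasurableSpace Ω] {P : Measure Ω} {K : ℝ → ℝ} {lam β : ℝ}
  {W F : StationaryRandomDistribution P} {ν : Measure ℝ} {ξ : GaussianRandomMeasure ν P}

/-- Removes the evenness restriction. A nonnegative `χ` is dominated by its symmetrization, for
which the estimate is known, so no symmetry of `ν` is needed. -/
theorem lintegral_symbol_sq_le (hK : AdmissibleKernel K) (hlam : 0 < lam) (hβ : 0 ≤ β)
    (hW : IsWhiteNoise W) (hF : HasCovarianceKernel F K)
    (hV : IsWeakSolution 0 lam β K W F ξ) {δ R : ℝ} (hδ : 0 < δ) {χ : 𝓢(ℝ, ℝ)}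
    (hpos : ∀ ω, 0 ≤ χ ω) (h0 : ∀ ω, |ω| < δ ∨ R < |ω| → χ ω = 0) :
    ∫⁻ ω, ENNReal.ofReal (‖symbol K lam β ω‖ ^ 2 * χ ω ^ 2) ∂ν
      ≤ ∫⁻ ω, ENNReal.ofReal (8 / Real.pi * (symbol K lam β ω).re * χ ω ^ 2) := by
  have hρ := isAnnular_evenPart hδ h0
  have hre : ∀ ω, 0 ≤ (symbol K lam β ω).re := fun ω => hlam.le.trans (le_re_symbol hK hβ ω)
  have hi1 : Integrable (fun ω => ‖symbol K lam β ω‖ ^ 2 * evenPart χ ω ^ 2) ν := by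
    have := (memLp_two_iff_integrable_sq_norm
      (hρ.memLp (lam := lam) (β := β) hK hV.isSpectralMeasure).1).mp
      (hρ.memLp hK hV.isSpectralMeasure)
    refine this.congr (Eventually.of_forall fun ω => ?_)
    simp [complexify_apply, mul_pow]
  have hi2 := hρ.integrable_re_symbol (lam := lam) (β := β) hK
  set g : ℝ → ℝ≥0∞ := fun ω => ENNReal.ofReal ((symbol K lam β ω).re * χ ω ^ 2) with hg
  have hgmeas : Measurable g := by
    refine Measurable.ennreal_ofReal ?_
    exact (Complex.measurable_re.comp (measurable_symbol hK)).mul (χ.continuous.measurable.pow_const 2)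
  have hgneg : ∫⁻ ω, g (-ω) = ∫⁻ ω, g ω :=
    (Measure.measurePreserving_neg (volume : Measure ℝ)).lintegral_comp hgmeas
  calc _ ≤ ∫⁻ ω, ENNReal.ofReal (‖symbol K lam β ω‖ ^ 2 * evenPart χ ω ^ 2) ∂ν := by
        refine lintegral_mono fun ω => ENNReal.ofReal_le_ofReal ?_
        refine mul_le_mul_of_nonneg_left ?_ (by positivity)
        exact pow_le_pow_left₀ (hpos ω) (by rw [evenPart_apply]; linarith [hpos (-ω)]) 2
    _ = ENNReal.ofReal (∫ ω, ‖symbol K lam β ω‖ ^ 2 * evenPart χ ω ^ 2 ∂ν) :=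
        (ofReal_integral_eq_lintegral_ofReal hi1
          (Eventually.of_forall fun ω => by positivity)).symm
    _ ≤ ENNReal.ofReal (2 / Real.pi * ∫ ω, (symbol K lam β ω).re * evenPart χ ω ^ 2) :=
        ENNReal.ofReal_le_ofReal (integral_symbol_sq_le hK hlam hβ hW hF hV hρ)
    _ = ENNReal.ofReal (2 / Real.pi)
          * ∫⁻ ω, ENNReal.ofReal ((symbol K lam β ω).re * evenPart χ ω ^ 2) := by
        rw [ENNReal.ofReal_mul (by positivity), ofReal_integral_eq_lintegral_ofReal hi2
          (Eventually.of_forall fun ω => mul_nonneg (hre ω) (sq_nonneg _))]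
    -- From `(x + y)² ≤ 2x² + 2y²` and the evenness of `Re z`. By reflection invariance both halves
    -- are equal, whence the factor `4` and the constant `8/π`.
    _ ≤ ENNReal.ofReal (2 / Real.pi) * ∫⁻ ω, (2 * g ω + 2 * g (-ω)) := by
        gcongr with ω
        have h2 : (2 : ℝ≥0∞) = ENNReal.ofReal 2 := by simp
        rw [hg, h2, ← ENNReal.ofReal_mul zero_le_two, ← ENNReal.ofReal_mul zero_le_two,
          ← ENNReal.ofReal_add
            (mul_nonneg zero_le_two (mul_nonneg (hre ω) (sq_nonneg _)))
            (mul_nonneg zero_le_two (mul_nonneg (hre (-ω)) (sq_nonneg _))),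
          re_symbol_neg hK, evenPart_apply]
        refine ENNReal.ofReal_le_ofReal ?_
        nlinarith [mul_nonneg (hre ω) (sq_nonneg (χ ω - χ (-ω)))]
    _ = ENNReal.ofReal (2 / Real.pi) * (4 * ∫⁻ ω, g ω) := by
        rw [lintegral_add_left (hgmeas.const_mul 2), lintegral_const_mul 2 hgmeas,
          lintegral_const_mul 2 (show Measurable fun ω => g (-ω) from hgmeas.comp measurable_neg),
          hgneg, ← add_mul]
        norm_num
    _ = _ := by
        have h4 : (4 : ℝ≥0∞) = ENNReal.ofReal 4 := by simp
        rw [← mul_assoc, h4, ← ENNReal.ofReal_mul (by positivity), ← lintegral_const_mul _ hgmeas]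
        refine lintegral_congr fun ω => ?_
        rw [hg, ← ENNReal.ofReal_mul (by positivity)]
        congr 1
        ring

/-- The integrated estimate becomes an inequality between the measures `|z|² ν` on the closed
annulus and `(8/π) Re z dω` on a larger open one. Dividing by the density `|z|²` isolates `ν`. The
restrictions to annuli make both measures finite. -/
theorem spectralMeasure_inter_closedAnnulus_le (hK : AdmissibleKernel K) (hlam : 0 < lam)
    (hβ : 0 ≤ β) (hW : IsWhiteNoise W) (hF : HasCovarianceKernel F K)
    (hV : IsWeakSolution 0 lam β K W F ξ) {δ R : ℝ} (hδ : 0 < δ) {E : Set ℝ}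
    (hE : MeasurableSet E) :
    ν (E ∩ closedAnnulus δ R) ≤ ENNReal.ofReal (8 / (Real.pi * lam)) * volume E := by
  have := hV.isSpectralMeasure.isFiniteMeasureOnCompacts
  have hz := measurable_symbol (lam := lam) (β := β) hK
  set A := closedAnnulus δ R
  set U := annulus (δ / 2) (R + 1)
  have hre : ∀ ω, lam ≤ (symbol K lam β ω).re := le_re_symbol hK hβ
  have hnorm : ∀ ω, 0 < ‖symbol K lam β ω‖ := fun ω =>
    hlam.trans_le ((hre ω).trans (Complex.re_le_norm _))
  obtain ⟨M, hM, hMz⟩ := exists_norm_symbol_le hK lam β (half_pos hδ)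
  have hAmeas : MeasurableSet A := (isCompact_closedAnnulus δ R).measurableSet
  have hUmeas : MeasurableSet U := (isOpen_annulus _ _).measurableSet
  have hAU : A ⊆ U := fun ω hω => ⟨by linarith [hω.1], by linarith [hω.2]⟩
  set w₁ : ℝ → ℝ≥0∞ := fun ω => ENNReal.ofReal (‖symbol K lam β ω‖ ^ 2) with hw₁
  set w₂ : ℝ → ℝ≥0∞ := fun ω => ENNReal.ofReal (8 / Real.pi * (symbol K lam β ω).re) with hw₂
  have hw₁m : Measurable w₁ := (hz.norm.pow_const 2).ennreal_ofReal
  have hw₂m : Measurable w₂ := ((Complex.measurable_re.comp hz).const_mul _).ennreal_ofReal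
  have hAfin : ν A < ∞ := (isCompact_closedAnnulus δ R).measure_lt_top
  have hUfin : volume U < ∞ := (measure_mono (annulus_subset_closedAnnulus _ _)).trans_lt
    (isCompact_closedAnnulus _ _).measure_lt_top
  have hf₁ : IsFiniteMeasure ((ν.restrict A).withDensity w₁) := by
    refine isFiniteMeasure_withDensity (ne_of_lt ?_)
    calc ∫⁻ ω in A, w₁ ω ∂ν ≤ ∫⁻ ω in A, ENNReal.ofReal (M ^ 2) ∂ν := by
          refine setLIntegral_mono' hAmeas fun ω hω => ENNReal.ofReal_le_ofReal ?_
          exact pow_le_pow_left₀ (norm_nonneg _) (hMz ω (hAU hω).1.le) 2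
      _ < ∞ := by
          rw [setLIntegral_const]
          exact ENNReal.mul_lt_top ENNReal.ofReal_lt_top hAfin
  have hf₂ : IsFiniteMeasure ((volume.restrict U).withDensity w₂) := by
    refine isFiniteMeasure_withDensity (ne_of_lt ?_)
    calc ∫⁻ ω in U, w₂ ω ≤ ∫⁻ ω in U, ENNReal.ofReal (8 / Real.pi * M) := by
          refine setLIntegral_mono' hUmeas fun ω hω => ENNReal.ofReal_le_ofReal ?_
          exact mul_le_mul_of_nonneg_left ((Complex.re_le_norm _).trans (hMz ω hω.1.le))
            (by positivity)
      _ < ∞ := by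
          rw [setLIntegral_const]
          exact ENNReal.mul_lt_top ENNReal.ofReal_lt_top hUfin
  have hle : (ν.restrict A).withDensity w₁ ≤ (volume.restrict U).withDensity w₂ := by
    refine measure_le_of_forall_lintegral_contDiff_le (isCompact_closedAnnulus δ R)
      (isOpen_annulus (δ / 2) (R + 1)) hAU ?_ fun χ hχ h01 h0 => ?_
    · refine withDensity_absolutelyContinuous _ _ ?_
      rw [Measure.restrict_apply hAmeas.compl, Set.compl_inter_self, measure_empty]
    · obtain ⟨f, hf⟩ := exists_schwartz_of_contDiff hχ h0
      have h := lintegral_symbol_sq_le hK hlam hβ hW hF hV (half_pos hδ) (R := R + 1) (χ := f)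
        (fun ω => by rw [hf]; exact (h01 ω).1) fun ω hω => by
          rw [hf]
          refine h0 ω fun hω' => ?_
          rcases hω with hω | hω
          · exact absurd hω'.1 (not_lt.mpr hω.le)
          · exact absurd hω'.2 (not_lt.mpr hω.le)
      have hχm : Measurable fun ω => ENNReal.ofReal (χ ω ^ 2) :=
        (hχ.continuous.measurable.pow_const 2).ennreal_ofReal
      rw [lintegral_withDensity_eq_lintegral_mul _ hw₁m hχm,
        lintegral_withDensity_eq_lintegral_mul _ hw₂m hχm]
      calc _ ≤ ∫⁻ ω, (w₁ * fun ω => ENNReal.ofReal (χ ω ^ 2)) ω ∂ν := setLIntegral_le_lintegral _ _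
        _ = ∫⁻ ω, ENNReal.ofReal (‖symbol K lam β ω‖ ^ 2 * f ω ^ 2) ∂ν := by
          refine lintegral_congr fun ω => ?_
          rw [hf, ENNReal.ofReal_mul (by positivity)]
          rfl
        _ ≤ _ := h
        _ = ∫⁻ ω, U.indicator (w₂ * fun ω => ENNReal.ofReal (χ ω ^ 2)) ω := by
          refine lintegral_congr fun ω => ?_
          by_cases hω : ω ∈ U
          · rw [Set.indicator_of_mem hω, hf, ENNReal.ofReal_mul
              (mul_nonneg (by positivity) (hlam.le.trans (hre ω)))]
            rfl
          · rw [Set.indicator_of_notMem hω, hf, h0 ω hω]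
            simp
        _ = _ := lintegral_indicator hUmeas _
  have hinv : ∀ ω, w₁ ω * (w₁ ω)⁻¹ = 1 := fun ω =>
    ENNReal.mul_inv_cancel (by simpa [hw₁] using (hnorm ω).ne') ENNReal.ofReal_ne_top
  calc ν (E ∩ A) = ∫⁻ ω in E, 1 ∂(ν.restrict A) := by
        rw [setLIntegral_one, Measure.restrict_apply hE]
    _ = ∫⁻ ω in E, (w₁ ω)⁻¹ ∂((ν.restrict A).withDensity w₁) := by
        refine Eq.trans (lintegral_congr fun ω => (hinv ω).symm)
          (setLIntegral_withDensity_eq_setLIntegral_mul _ hw₁m hw₁m.inv hE).symm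
    _ ≤ ∫⁻ ω in E, (w₁ ω)⁻¹ ∂((volume.restrict U).withDensity w₂) :=
        lintegral_mono' (Measure.restrict_mono le_rfl hle) le_rfl
    _ = ∫⁻ ω in E, w₂ ω * (w₁ ω)⁻¹ ∂(volume.restrict U) :=
        setLIntegral_withDensity_eq_setLIntegral_mul _ hw₂m hw₁m.inv hE
    _ ≤ ∫⁻ ω in E, ENNReal.ofReal (8 / (Real.pi * lam)) ∂(volume.restrict U) := by
        refine lintegral_mono fun ω => ?_
        rw [hw₁, hw₂]
        simp only
        rw [← ENNReal.ofReal_inv_of_pos (pow_pos (hnorm ω) 2), ← ENNReal.ofReal_mul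
          (mul_nonneg (by positivity) (hlam.le.trans (hre ω)))]
        refine ENNReal.ofReal_le_ofReal ?_
        have h1 := Complex.re_le_norm (symbol K lam β ω)
        have h2 := (hre ω).trans h1
        have h3 := hnorm ω
        rw [← div_eq_mul_inv, div_le_div_iff₀ (by positivity) (by positivity)]
        -- This is `Re z / |z|² ≤ 1 / lam`, which makes the final constant independent of the
        -- annulus.
        have h4 : lam * (symbol K lam β ω).re ≤ ‖symbol K lam β ω‖ ^ 2 := by
          rw [sq]
          exact mul_le_mul h2 h1 (hlam.le.trans (hre ω)) h3.le
        calc _ = 8 * (lam * (symbol K lam β ω).re) := by field_simp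
          _ ≤ _ := by gcongr
    _ ≤ _ := by
        rw [setLIntegral_const]
        gcongr
        exact Measure.restrict_le_self

/-- The spectral measure is bounded by a multiple of the Lebesgue measure. -/
theorem spectralMeasure_le (hK : AdmissibleKernel K) (hlam : 0 < lam)
    (hβ : 0 ≤ β) (hW : IsWhiteNoise W) (hF : HasCovarianceKernel F K)
    (hV : IsWeakSolution 0 lam β K W F ξ) :
    ν ≤ ENNReal.ofReal (8 / (Real.pi * lam)) • (volume : Measure ℝ) := by
  refine Measure.le_iff.mpr fun E hE => ?_
  rw [Measure.smul_apply, smul_eq_mul]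
  -- These annuli exhaust the line except for the origin, which is `ν`-null by absolute continuity.
  set B : ℕ → Set ℝ := fun n => closedAnnulus ((n : ℝ) + 1)⁻¹ (n + 1)
  have hmono : Monotone fun n => E ∩ B n := by
    intro m n hmn
    have hmn' : (m : ℝ) ≤ n := by exact_mod_cast hmn
    refine Set.inter_subset_inter_right _ fun ω hω => ⟨le_trans ?_ hω.1, hω.2.trans (by linarith)⟩
    gcongr
  have hunion : E ⊆ (⋃ n, E ∩ B n) ∪ {0} := by
    intro ω hω
    by_cases h : ω = 0
    · exact Or.inr h
    · left
      obtain ⟨n, hn⟩ := exists_nat_ge (max |ω| |ω|⁻¹)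
      have h1 := (le_max_left _ _).trans hn
      have h2 := (le_max_right _ _).trans hn
      refine Set.mem_iUnion.mpr ⟨n, hω, ?_, by linarith⟩
      rw [inv_le_comm₀ (by positivity) (abs_pos.mpr h)]
      linarith
  have h0 : ν {0} = 0 := hV.isSpectralMeasure.absolutelyContinuous (by simp)
  calc ν E ≤ ν (⋃ n, E ∩ B n) + ν {0} := (measure_mono hunion).trans (measure_union_le _ _)
    _ = ⨆ n, ν (E ∩ B n) := by rw [h0, add_zero, hmono.measure_iUnion]
    _ ≤ _ := iSup_le fun n => spectralMeasure_inter_closedAnnulus_le hK hlam hβ hW hF hV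
        (by positivity) hE

/-- The spectral measure is infinite. -/
theorem spectralMeasure_univ (hK : AdmissibleKernel K) (hlam : 0 < lam)
    (hβ : 0 ≤ β) (hW : IsWhiteNoise W) (hF : HasCovarianceKernel F K)
    (hV : IsWeakSolution 0 lam β K W F ξ) : ν Set.univ = ∞ := by
  by_contra hfin
  have hν : IsFiniteMeasure ν := ⟨lt_top_iff_ne_top.mpr hfin⟩
  obtain ⟨δ, hδ0, hδ⟩ : ∃ δ : ℝ, 0 < δ ∧
      ∀ ω, δ ≤ |ω| → β * (halfFourier K ω).re ≤ lam / 4 := by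
    have h1 : Tendsto (fun ω => β * (halfFourier K ω).re) (cocompact ℝ) (𝓝 (β * 0)) :=
      ((Complex.continuous_re.tendsto _).comp hK.tendsto_halfFourier).const_mul β
    rw [mul_zero] at h1
    have h2 := h1.eventually (ge_mem_nhds (show (0 : ℝ) < lam / 4 by positivity))
    rw [← Metric.cobounded_eq_cocompact, ← comap_norm_atTop] at h2
    obtain ⟨s, hs, hsub⟩ := h2
    obtain ⟨a, ha⟩ := mem_atTop_sets.mp hs
    refine ⟨max a 1, by positivity, fun ω hω => hsub (ha _ ((le_max_left _ _).trans hω))⟩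
  obtain ⟨M, hM0, hM⟩ := exists_norm_symbol_le hK lam β hδ0
  -- If `ν` were finite, the left side of the weak equation would be bounded uniformly in the test
  -- function, since `|z| ≤ M` on its support and the symmetrized cutoff is at most `2`. The white
  -- noise, however, contributes at least a multiple of the length `n` of the plateau.
  have key : ∀ n : ℕ, lam / (4 * Real.pi) * n ≤ M ^ 2 * 4 * ν.real Set.univ := by
    intro n
    obtain ⟨χ, hχ, h01, h0, h1⟩ := exists_contDiff_indicator_between
      (A := Set.Icc (δ + 1) (δ + 1 + n)) isClosed_Icc (isOpen_annulus δ (δ + 2 + n)) (by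
        intro ω hω
        have : |ω| = ω := abs_of_pos (by linarith [hω.1])
        exact ⟨by rw [this]; linarith [hω.1], by rw [this]; linarith [hω.2]⟩)
    obtain ⟨f, hf⟩ := exists_schwartz_of_contDiff hχ h0
    have hρ : IsAnnular (evenPart f) δ (δ + 2 + n) := isAnnular_evenPart hδ0 fun ω hω => by
      rw [hf]
      refine h0 ω fun hω' => ?_
      rcases hω with hω | hω
      · exact absurd hω'.1 (not_lt.mpr hω.le)
      · exact absurd hω'.2 (not_lt.mpr hω.le)
    have h := le_integral_symbol_sq hK hlam hβ hW hF hV hρ hδ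
    have hlow : (n : ℝ) ≤ ∫ ω, evenPart f ω ^ 2 := by
      have e : ∫ ω, (Set.Icc (δ + 1) (δ + 1 + n)).indicator (fun _ => (1 : ℝ)) ω = n := by
        rw [integral_indicator measurableSet_Icc]
        simp
      rw [← e]
      refine integral_mono ((integrable_indicator_iff measurableSet_Icc).mpr
        (integrableOn_const isCompact_Icc.measure_lt_top.ne)) (integrable_schwartz_sq _) fun ω => ?_
      by_cases hω : ω ∈ Set.Icc (δ + 1) (δ + 1 + n)
      · simp only [Set.indicator_of_mem hω, evenPart_apply, hf, h1 ω hω]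
        nlinarith [(h01 (-ω)).1]
      · simp only [Set.indicator_of_notMem hω]
        positivity
    have hup : ∫ ω, ‖symbol K lam β ω‖ ^ 2 * evenPart f ω ^ 2 ∂ν
        ≤ M ^ 2 * 4 * ν.real Set.univ := by
      rw [mul_comm (M ^ 2 * 4), ← smul_eq_mul, ← integral_const]
      refine integral_mono_of_nonneg (Eventually.of_forall fun ω => by positivity)
        (integrable_const _) (Eventually.of_forall fun ω => ?_)
      simp only
      by_cases hω : |ω| < δ
      · rw [hρ.zero_of_lt ω hω]
        nlinarith [sq_nonneg M]
      · have e1 : ‖symbol K lam β ω‖ ^ 2 ≤ M ^ 2 :=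
          pow_le_pow_left₀ (norm_nonneg _) (hM ω (not_lt.mp hω)) 2
        have e2 : evenPart f ω ^ 2 ≤ 4 := by
          rw [evenPart_apply, hf, hf]
          nlinarith [(h01 ω).1, (h01 ω).2, (h01 (-ω)).1, (h01 (-ω)).2]
        exact mul_le_mul e1 e2 (sq_nonneg _) (sq_nonneg _)
    have hc : 0 < lam / (4 * Real.pi) := by positivity
    nlinarith
  obtain ⟨n, hn⟩ := exists_nat_gt (M ^ 2 * 4 * ν.real Set.univ / (lam / (4 * Real.pi)))
  rw [div_lt_iff₀ (by positivity)] at hn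
  linarith [key n]

end Spectral

/-! ### The velocity -/

theorem represents_distribFourier_delta (t : ℝ) :
    Represents (distribFourier (TemperedDistribution.delta t))
      (fun ω => Complex.exp (-(Complex.I * ω * t))) := by
  intro φ
  refine ⟨?_, ?_⟩
  · simpa only [mul_comm] using integrable_mul_exp φ.integrable t
  · rw [distribFourier_apply, TemperedDistribution.delta_apply, schwartzFourier_apply]
    simp only [mul_comm]

/-- Any function representing the transform has modulus one almost everywhere, and constants are
square integrable only for finite measures. -/
theorem delta_notMem_Dom {ν : Measure ℝ} (hν : ν ≪ volume) (huniv : ν Set.univ = ∞) (t : ℝ) :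
    TemperedDistribution.delta t ∉ Dom ν := by
  rintro ⟨h, hrep, hmem⟩
  have heq := hν.ae_le (represents_unique hrep (represents_distribFourier_delta t))
  have h1 : MemLp (fun _ : ℝ => (1 : ℂ)) 2 ν := by
    refine (memLp_congr_norm aestronglyMeasurable_const hmem.1 ?_).mpr hmem
    filter_upwards [heq] with ω hω
    rw [hω, norm_exp_neg_I_mul_mul, norm_one]
  rw [memLp_const_iff (by simp) (by simp)] at h1
  simp [huniv] at h1

/-! ### The position -/

/-- The Fourier transform of `1_{[0,t]}`. -/
def indicatorFourier (t ω : ℝ) : ℂ := ∫ x, indicatorIcc t x * Complex.exp (-(Complex.I * x * ω))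

theorem memLp_indicatorIcc (t : ℝ) (p : ℝ≥0∞) : MemLp (indicatorIcc t) p :=
  memLp_indicator_const p measurableSet_Icc (1 : ℂ) (Or.inr isCompact_Icc.measure_lt_top.ne)

theorem integrable_indicatorIcc (t : ℝ) : Integrable (indicatorIcc t) :=
  memLp_one_iff_integrable.mp (memLp_indicatorIcc t 1)

theorem isTempered_indicatorIcc (t : ℝ) : IsTempered (indicatorIcc t) := by
  refine ⟨Lp.toTemperedDistribution ((memLp_indicatorIcc t 1).toLp (indicatorIcc t)), fun φ => ?_⟩
  obtain ⟨C, hC0, hC⟩ := exists_norm_le_inv_one_add_sq φ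
  refine ⟨(integrable_indicatorIcc t).mul_bdd (c := C) φ.continuous.aestronglyMeasurable
    (Eventually.of_forall fun x => (hC x).trans ?_), ?_⟩
  · exact mul_le_of_le_one_right hC0 (inv_le_one_of_one_le₀ (by nlinarith [sq_nonneg x]))
  · rw [Lp.toTemperedDistribution_apply]
    refine integral_congr_ae ((memLp_indicatorIcc t 1).coeFn_toLp.mono fun x hx => ?_)
    simp only [hx, smul_eq_mul, mul_comm]

theorem continuous_indicatorFourier (t : ℝ) : Continuous (indicatorFourier t) := by
  refine continuous_of_dominated (bound := fun x => ‖indicatorIcc t x‖)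
    (fun ω => (integrable_mul_exp (integrable_indicatorIcc t) ω).1)
    (fun ω => Eventually.of_forall fun x => ?_) (integrable_indicatorIcc t).norm
    (Eventually.of_forall fun x => by fun_prop)
  rw [norm_mul, norm_exp_neg_I_mul_mul, mul_one]

theorem indicatorFourier_eq {t : ℝ} (ht : 0 ≤ t) (ω : ℝ) :
    indicatorFourier t ω = ∫ x in (0 : ℝ)..t, Complex.exp (-(Complex.I * x * ω)) := by
  rw [indicatorFourier, intervalIntegral.integral_of_le ht, ← integral_Icc_eq_integral_Ioc,
    ← integral_indicator measurableSet_Icc]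
  refine integral_congr_ae (Eventually.of_forall fun x => ?_)
  by_cases hx : x ∈ Set.Icc 0 t <;> simp [indicatorIcc, hx]

theorem indicatorFourier_sub {s t : ℝ} (hs : 0 ≤ s) (ht : 0 ≤ t) (ω : ℝ) :
    indicatorFourier t ω - indicatorFourier s ω
      = ∫ x in s..t, Complex.exp (-(Complex.I * x * ω)) := by
  have hi : ∀ a b : ℝ, IntervalIntegrable (fun x : ℝ => Complex.exp (-(Complex.I * x * ω)))
      volume a b := fun a b => Continuous.intervalIntegrable (by fun_prop) a b
  rw [indicatorFourier_eq ht, indicatorFourier_eq hs,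
    intervalIntegral.integral_interval_sub_left (hi _ _) (hi _ _)]

/-- An integrable majorant of the squared Fourier transform of an indicator function. -/
def fejerBound (δ ω : ℝ) : ℝ := 2 * δ ^ 2 * (1 + (δ / 2 * ω) ^ 2)⁻¹

theorem fejerBound_nonneg (δ ω : ℝ) : 0 ≤ fejerBound δ ω := by
  unfold fejerBound
  positivity

theorem integrable_fejerBound (δ : ℝ) : Integrable (fejerBound δ) := by
  by_cases hδ : δ = 0
  · have : fejerBound δ = fun _ => 0 := by ext; simp [fejerBound, hδ]
    rw [this]
    exact integrable_zero _ _ _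
  · exact (integrable_inv_one_add_sq.comp_mul_left' (by simpa using hδ)).const_mul _

theorem integral_fejerBound {δ : ℝ} (hδ : 0 ≤ δ) : ∫ ω, fejerBound δ ω = 4 * Real.pi * δ := by
  rcases hδ.eq_or_lt with rfl | hδ
  · simp [fejerBound]
  · simp only [fejerBound]
    rw [integral_const_mul, Measure.integral_comp_mul_left (fun x : ℝ => (1 + x ^ 2)⁻¹) (δ / 2),
      integral_univ_inv_one_add_sq, abs_of_pos (by positivity), smul_eq_mul]
    field_simp
    norm_num

/-- Two bounds on `∫ e^{-ixω} dx` over `[s, t]`, namely `|t - s|` and `2 / |ω|`, are merged into one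
Cauchy-type profile, whose integral is explicit and linear in `|t - s|`. -/
theorem norm_sq_indicatorFourier_sub_le {s t : ℝ} (hs : 0 ≤ s) (ht : 0 ≤ t) (ω : ℝ) :
    ‖indicatorFourier t ω - indicatorFourier s ω‖ ^ 2 ≤ fejerBound |t - s| ω := by
  rw [indicatorFourier_sub hs ht]
  set d := ∫ x in s..t, Complex.exp (-(Complex.I * x * ω)) with hd
  have h1 : ‖d‖ ≤ |t - s| := by
    have := intervalIntegral.norm_integral_le_of_norm_le_const (a := s) (b := t)
      (f := fun x : ℝ => Complex.exp (-(Complex.I * x * ω))) (C := 1)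
      fun x _ => (norm_exp_neg_I_mul_mul x ω).le
    simpa using this
  have h2 : |ω| * ‖d‖ ≤ 2 := by
    by_cases hω : ω = 0
    · simp [hω]
    · have hc : -(Complex.I * ω) ≠ 0 := by
        simp [hω]
      have e : ∀ x : ℝ, -(Complex.I * x * ω) = -(Complex.I * ω) * x := fun x => by ring
      have h3 : (-(Complex.I * ω)) * d
          = Complex.exp (-(Complex.I * ω) * t) - Complex.exp (-(Complex.I * ω) * s) := by
        rw [hd]
        simp only [e]
        rw [integral_exp_mul_complex hc, mul_div_cancel₀ _ hc]
      have h4 : ‖(-(Complex.I * ω)) * d‖ = |ω| * ‖d‖ := by simp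
      rw [← h4, h3, ← e, ← e]
      refine (norm_sub_le _ _).trans ?_
      rw [norm_exp_neg_I_mul_mul, norm_exp_neg_I_mul_mul]
      norm_num
  rw [fejerBound, ← div_eq_mul_inv, le_div_iff₀ (by positivity)]
  have h5 : ‖d‖ ^ 2 ≤ |t - s| ^ 2 := pow_le_pow_left₀ (norm_nonneg _) h1 2
  have h6 : (|ω| * ‖d‖) ^ 2 ≤ 2 ^ 2 := pow_le_pow_left₀ (by positivity) h2 2
  rw [mul_pow, sq_abs] at h6
  nlinarith [sq_nonneg |t - s|]

theorem represents_distribFourier_indicatorIcc (t : ℝ) :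
    Represents (distribFourier (ofFun (indicatorIcc t))) (indicatorFourier t) := by
  intro θ
  refine ⟨?_, ?_⟩
  · refine (θ.integrable.bdd_mul (c := ∫ x, ‖indicatorIcc t x‖)
      (continuous_indicatorFourier t).aestronglyMeasurable (Eventually.of_forall fun ω => ?_))
    refine (norm_integral_le_integral_norm _).trans (le_of_eq ?_)
    simp only [norm_mul, norm_exp_neg_I_mul_mul, mul_one]
  · rw [distribFourier_apply, (represents_ofFun (isTempered_indicatorIcc t) _).2]
    simp only [schwartzFourier_apply]
    exact integral_mul_integral_exp_swap (integrable_indicatorIcc t) θ.integrable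

section Bounded

variable {ν : Measure ℝ} {c : ℝ≥0}

theorem integrable_fejerBound_of_le (hν : ν ≤ c • volume) (δ : ℝ) :
    Integrable (fejerBound δ) ν :=
  ((integrable_fejerBound δ).smul_measure_nnreal (c := c)).mono_measure hν

theorem memLp_indicatorFourier (hν : ν ≤ c • volume) {t : ℝ} (ht : 0 ≤ t) :
    MemLp (indicatorFourier t) 2 ν := by
  refine (memLp_two_iff_integrable_sq_norm
    (continuous_indicatorFourier t).aestronglyMeasurable).mpr ?_
  refine (integrable_fejerBound_of_le hν |t - 0|).mono'
    ((continuous_indicatorFourier t).norm.pow 2).aestronglyMeasurable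
    (Eventually.of_forall fun ω => ?_)
  rw [Real.norm_of_nonneg (by positivity)]
  have h0 : indicatorFourier 0 ω = 0 := by rw [indicatorFourier_eq le_rfl]; simp
  simpa [h0] using norm_sq_indicatorFourier_sub_le le_rfl ht ω

theorem memLp_conj_indicatorFourier (hν : ν ≤ c • volume) {t : ℝ} (ht : 0 ≤ t) :
    MemLp (fun ω => conj (indicatorFourier t ω)) 2 ν :=
  (memLp_indicatorFourier hν ht).star

theorem ofFun_indicatorIcc_mem_Dom (hν : ν ≤ c • volume) {t : ℝ} (ht : 0 ≤ t) :
    ofFun (indicatorIcc t) ∈ Dom ν :=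
  ⟨_, represents_distribFourier_indicatorIcc t, memLp_indicatorFourier hν ht⟩

variable {Ω : Type*} [MeasurableSpace Ω] {P : Measure Ω}

theorem GaussianRandomMeasure.position_eq (ξ : GaussianRandomMeasure ν P) (hν : ν ≤ c • volume)
    (t : ℝ≥0) : ξ.position t =
    ξ.integralL2 (MemLp.toLp (fun ω => conj (indicatorFourier t ω))
      (memLp_conj_indicatorFourier hν t.coe_nonneg)) := by
  have hac : ν ≪ volume :=
    (Measure.absolutelyContinuous_of_le hν).trans (Measure.smul_absolutelyContinuous)
  rw [position, ξ.op_eq hac (represents_distribFourier_indicatorIcc t)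
    (memLp_indicatorFourier hν t.coe_nonneg), GaussianRandomMeasure.integral]
  exact dif_pos (memLp_conj_indicatorFourier hν t.coe_nonneg)

/-- Isometry turns the variance into a `ν`-integral; the bound of `ν` by Lebesgue measure then
reduces it to the integral of `fejerBound`, which is `4π |t - s|`. -/
theorem GaussianRandomMeasure.norm_sq_position_sub_le (ξ : GaussianRandomMeasure ν P)
    (hν : ν ≤ c • volume) (s t : ℝ≥0) :
    ‖ξ.position t - ξ.position s‖ ^ 2 ≤ c * (4 * Real.pi * |(t : ℝ) - s|) := by
  rw [ξ.position_eq hν, ξ.position_eq hν, ← map_sub, norm_integralL2, ← MemLp.toLp_sub,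
    ← Lp_integral_norm_sq]
  calc _ = ∫ ω, ‖indicatorFourier t ω - indicatorFourier s ω‖ ^ 2 ∂ν := by
        refine integral_congr_ae ((((memLp_conj_indicatorFourier hν t.coe_nonneg).sub
          (memLp_conj_indicatorFourier hν s.coe_nonneg)).coeFn_toLp).mono fun ω hω => ?_)
        simp only [hω, Pi.sub_apply, ← map_sub, RCLike.norm_conj]
    _ ≤ ∫ ω, fejerBound |(t : ℝ) - s| ω ∂ν :=
        integral_mono_of_nonneg (Eventually.of_forall fun ω => by positivity)
          (integrable_fejerBound_of_le hν _)
          (Eventually.of_forall fun ω => norm_sq_indicatorFourier_sub_le s.coe_nonneg t.coe_nonneg ω)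
    _ ≤ ∫ ω, fejerBound |(t : ℝ) - s| ω ∂(c • volume) :=
        integral_mono_measure hν (Eventually.of_forall fun ω => fejerBound_nonneg _ ω)
          ((integrable_fejerBound _).smul_measure_nnreal)
    _ = _ := by
        rw [integral_smul_nnreal_measure, integral_fejerBound (abs_nonneg _)]
        rfl

end Bounded

/-! ### Fourth moments of Gaussian variables -/

/-- The fourth moment of the standard normal distribution. -/
def normalFourthMoment : ℝ := ∫ x, x ^ 4 ∂gaussianReal 0 1

theorem normalFourthMoment_nonneg : 0 ≤ normalFourthMoment :=
  integral_nonneg fun x => by positivity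

section Gaussian

variable {Ω : Type*} [MeasurableSpace Ω] {P : Measure Ω}

/-- Scaling: a centered Gaussian of variance `v` has the law of `√v` times a standard one. The
numerical value of the fourth moment plays no role. -/
theorem integral_pow_four_of_hasGaussianLaw {X : Ω → ℝ} (hX : HasGaussianLaw X P)
    (h0 : ∫ x, X x ∂P = 0) :
    ∫ x, X x ^ 4 ∂P = normalFourthMoment * (∫ x, X x ^ 2 ∂P) ^ 2 := by
  have hvar : Var[X; P] = ∫ x, X x ^ 2 ∂P := variance_of_integral_eq_zero hX.aemeasurable h0
  have hv0 : 0 ≤ ∫ x, X x ^ 2 ∂P := integral_nonneg fun x => by positivity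
  have hmap := hX.map_eq_gaussianReal
  rw [h0, hvar] at hmap
  set v := ∫ x, X x ^ 2 ∂P
  have h1 : gaussianReal 0 v.toNNReal = (gaussianReal 0 1).map (fun x => Real.sqrt v * x) := by
    rw [gaussianReal_map_const_mul]
    congr 1
    · simp
    · ext
      simp [Real.sq_sqrt hv0, hv0]
  have h2 : ∫ y, y ^ 4 ∂(P.map X) = ∫ x, X x ^ 4 ∂P :=
    integral_map hX.aemeasurable (by fun_prop)
  rw [← h2, hmap, h1, integral_map (by fun_prop) (by fun_prop), normalFourthMoment,
    ← integral_mul_const]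
  refine integral_congr_ae (Eventually.of_forall fun x => ?_)
  simp only
  have h3 : Real.sqrt v ^ 4 = v ^ 2 := by
    rw [show (4 : ℕ) = 2 * 2 from rfl, pow_mul, Real.sq_sqrt hv0]
  rw [mul_pow, h3, mul_comm]

theorem integrable_pow_four_of_hasGaussianLaw {X : Ω → ℝ} (hX : HasGaussianLaw X P) :
    Integrable (fun x => X x ^ 4) P := by
  have h := (hX.memLp (p := (4 : ℕ)) (by simp)).integrable_norm_pow (by norm_num)
  refine h.congr (Eventually.of_forall fun x => ?_)
  simp only [Real.norm_eq_abs]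
  exact (Even.pow_abs (by decide) _)

/-- The fourth moment of a complex variable with Gaussian real and imaginary parts. -/
theorem lintegral_enorm_pow_four_le {Z : Lp ℂ 2 P}
    (hre : HasGaussianLaw (fun x => (Z x).re) P) (him : HasGaussianLaw (fun x => (Z x).im) P)
    (hre0 : ∫ x, (Z x).re ∂P = 0) (him0 : ∫ x, (Z x).im ∂P = 0) :
    ∫⁻ x, ‖Z x‖ₑ ^ 4 ∂P ≤ ENNReal.ofReal (2 * normalFourthMoment) * ‖Z‖ₑ ^ 4 := by
  set a := fun x => (Z x).re
  set b := fun x => (Z x).im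
  have hia := integrable_pow_four_of_hasGaussianLaw hre
  have hib := integrable_pow_four_of_hasGaussianLaw him
  have hsq : (∫ x, a x ^ 2 ∂P) + ∫ x, b x ^ 2 ∂P = ‖Z‖ ^ 2 := by
    rw [← Lp_integral_norm_sq, ← integral_add hre.memLp_two.integrable_sq
      him.memLp_two.integrable_sq]
    refine integral_congr_ae (Eventually.of_forall fun x => ?_)
    simp only [← Complex.normSq_eq_norm_sq, Complex.normSq_apply, a, b]
    ring
  have ha0 : 0 ≤ ∫ x, a x ^ 2 ∂P := integral_nonneg fun x => by positivity
  have hb0 : 0 ≤ ∫ x, b x ^ 2 ∂P := integral_nonneg fun x => by positivity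
  have hκ := normalFourthMoment_nonneg
  calc ∫⁻ x, ‖Z x‖ₑ ^ 4 ∂P
      ≤ ∫⁻ x, ENNReal.ofReal (2 * (a x ^ 4 + b x ^ 4)) ∂P := by
        refine lintegral_mono fun x => ?_
        rw [← ofReal_norm, ← ENNReal.ofReal_pow (norm_nonneg _)]
        refine ENNReal.ofReal_le_ofReal ?_
        have h1 : ‖Z x‖ ^ 2 = a x ^ 2 + b x ^ 2 := by
          rw [← Complex.normSq_eq_norm_sq, Complex.normSq_apply]
          ring
        have h2 : ‖Z x‖ ^ 4 = (a x ^ 2 + b x ^ 2) ^ 2 := by rw [← h1]; ring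
        rw [h2]
        nlinarith [sq_nonneg (a x ^ 2 - b x ^ 2)]
    _ = ENNReal.ofReal (∫ x, 2 * (a x ^ 4 + b x ^ 4) ∂P) :=
        (ofReal_integral_eq_lintegral_ofReal ((hia.add hib).const_mul 2)
          (Eventually.of_forall fun x => show (0 : ℝ) ≤ 2 * (a x ^ 4 + b x ^ 4) by positivity)).symm
    _ ≤ ENNReal.ofReal (2 * normalFourthMoment * ‖Z‖ ^ 4) := by
        refine ENNReal.ofReal_le_ofReal ?_
        rw [integral_const_mul, integral_add hia hib, integral_pow_four_of_hasGaussianLaw hre hre0,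
          integral_pow_four_of_hasGaussianLaw him him0, show (4 : ℕ) = 2 * 2 from rfl, pow_mul,
          ← hsq]
        -- The discarded cross term of the square of `𝔼a² + 𝔼b²`; no joint law of real and imaginary
        -- parts is involved.
        have : 0 ≤ normalFourthMoment * ((∫ x, a x ^ 2 ∂P) * ∫ x, b x ^ 2 ∂P) :=
          mul_nonneg hκ (mul_nonneg ha0 hb0)
        nlinarith
    _ = _ := by
        rw [ENNReal.ofReal_mul (mul_nonneg zero_le_two hκ), ← ofReal_norm,
          ENNReal.ofReal_pow (norm_nonneg _)]

theorem Lp_coeFn_sum {ι : Type*} (s : Finset ι) (f : ι → Lp ℂ 2 P) :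
    ⇑(∑ i ∈ s, f i) =ᵐ[P] fun x => ∑ i ∈ s, f i x := by
  classical
  induction s using Finset.induction_on with
  | empty =>
    simp only [Finset.sum_empty]
    exact Lp.coeFn_zero ℂ 2 P
  | insert i s hi ih =>
    rw [Finset.sum_insert hi]
    filter_upwards [Lp.coeFn_add (f i) (∑ j ∈ s, f j), ih] with x hx hx'
    rw [hx, Pi.add_apply, hx', Finset.sum_insert hi]

variable {ν : Measure ℝ}

/-- A real linear functional of a finite combination of the random measure is a centered Gaussian
variable. -/
theorem GaussianRandomMeasure.gaussian_linearCombination [IsProbabilityMeasure P]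
    (ξ : GaussianRandomMeasure ν P) (c : FiniteSets ν →₀ ℂ) (L : ℂ →L[ℝ] ℝ) :
    HasGaussianLaw (fun x => L ((Finsupp.linearCombination ℂ ξ.toFun c : Lp ℂ 2 P) x)) P ∧
      ∫ x, L ((Finsupp.linearCombination ℂ ξ.toFun c : Lp ℂ 2 P) x) ∂P = 0 := by
  have hZ : ⇑(Finsupp.linearCombination ℂ ξ.toFun c : Lp ℂ 2 P)
      =ᵐ[P] fun x => ∑ E ∈ c.support, c E * ξ.toFun E x := by
    rw [Finsupp.linearCombination_apply, Finsupp.sum]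
    filter_upwards [Lp_coeFn_sum c.support fun E => c E • ξ.toFun E,
      (eventually_countable_ball c.support.countable_toSet).mpr
        fun E _ => Lp.coeFn_smul (c E) (ξ.toFun E)] with x hx hx'
    rw [hx]
    exact Finset.sum_congr rfl fun E hE => by rw [hx' E hE]; rfl
  have hint : ∀ E, Integrable (ξ.toFun E) P := fun E =>
    (Lp.memLp (ξ.toFun E)).integrable (by norm_num)
  have hintsum : Integrable (fun x => ∑ E ∈ c.support, c E * ξ.toFun E x) P :=
    integrable_finsetSum _ fun E _ => (hint E).const_mul _
  constructor
  · have h := (ξ.gaussian.comp_left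
      fun E => L.comp (ContinuousLinearMap.mul ℝ ℂ (c E))).hasGaussianLaw_fun_sum (I := c.support)
    refine h.congr ?_
    filter_upwards [hZ] with x hx
    rw [hx, map_sum]
    rfl
  · rw [integral_congr_ae (hZ.mono fun x hx => congrArg L hx), L.integral_comp_comm hintsum,
      integral_finsetSum _ fun E _ => (hint E).const_mul _]
    simp only [integral_const_mul, ξ.centered, mul_zero, Finset.sum_const_zero, map_zero]

/-- The fourth moments of stochastic integrals. -/
theorem GaussianRandomMeasure.lintegral_enorm_integralL2_pow_four_le [IsProbabilityMeasure P]
    (ξ : GaussianRandomMeasure ν P) (g : Lp ℂ 2 ν) :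
    ∫⁻ x, ‖ξ.integralL2 g x‖ₑ ^ 4 ∂P
      ≤ ENNReal.ofReal (2 * normalFourthMoment) * ‖ξ.integralL2 g‖ₑ ^ 4 := by
  refine (denseRange_linearCombination ν).induction_on g (p := fun g =>
    ∫⁻ x, ‖ξ.integralL2 g x‖ₑ ^ 4 ∂P
      ≤ ENNReal.ofReal (2 * normalFourthMoment) * ‖ξ.integralL2 g‖ₑ ^ 4) ?_ fun c => ?_
  · refine IsSeqClosed.isClosed fun u f hu huf => ?_
    have hlim : Tendsto (fun n => ξ.integralL2 (u n)) atTop (𝓝 (ξ.integralL2 f)) :=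
      (ξ.integralL2.continuous.tendsto f).comp huf
    obtain ⟨ns, hns, hae⟩ := (tendstoInMeasure_of_tendsto_Lp hlim).exists_seq_tendsto_ae
    have hbound : Tendsto (fun n => ENNReal.ofReal (2 * normalFourthMoment)
        * ‖ξ.integralL2 (u (ns n))‖ₑ ^ 4) atTop
        (𝓝 (ENNReal.ofReal (2 * normalFourthMoment) * ‖ξ.integralL2 f‖ₑ ^ 4)) := by
      refine ENNReal.Tendsto.const_mul ?_ (Or.inr ENNReal.ofReal_ne_top)
      exact (((ENNReal.continuous_pow 4).comp continuous_enorm).tendsto _).comp (hlim.comp hns.tendsto_atTop)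
    calc ∫⁻ x, ‖ξ.integralL2 f x‖ₑ ^ 4 ∂P
        = ∫⁻ x, liminf (fun n => ‖ξ.integralL2 (u (ns n)) x‖ₑ ^ 4) atTop ∂P := by
          refine lintegral_congr_ae ?_
          filter_upwards [hae] with x hx
          exact ((((ENNReal.continuous_pow 4).comp continuous_enorm).tendsto _).comp hx).liminf_eq.symm
      _ ≤ liminf (fun n => ∫⁻ x, ‖ξ.integralL2 (u (ns n)) x‖ₑ ^ 4 ∂P) atTop :=
          lintegral_liminf_le fun n => (Lp.stronglyMeasurable _).enorm.pow_const 4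
      _ ≤ liminf (fun n => ENNReal.ofReal (2 * normalFourthMoment)
            * ‖ξ.integralL2 (u (ns n))‖ₑ ^ 4) atTop :=
          liminf_le_liminf (Eventually.of_forall fun n => hu (ns n))
      _ = _ := hbound.liminf_eq
  · have h := LinearMap.extendOfNorm_eq (denseRange_linearCombination ν)
      (f := Finsupp.linearCombination ℂ ξ.toFun)
      ⟨1, fun c => by rw [one_mul, norm_linearCombination ξ c]⟩ c
    rw [integralL2, h]
    exact lintegral_enorm_pow_four_le (ξ.gaussian_linearCombination c Complex.reCLM).1
      (ξ.gaussian_linearCombination c Complex.imCLM).1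
      (ξ.gaussian_linearCombination c Complex.reCLM).2
      (ξ.gaussian_linearCombination c Complex.imCLM).2

end Gaussian

/-! ### Continuous versions of processes -/

/-- The dyadic number `k / 2 ^ n`. -/
def dyadic (n k : ℕ) : ℝ≥0 := k / 2 ^ n

/-- The index of the dyadic interval of level `n` that contains `t`. -/
def dyadicIndex (n : ℕ) (t : ℝ≥0) : ℕ := ⌊2 ^ n * t⌋₊

theorem dyadic_succ_two_mul (n k : ℕ) : dyadic (n + 1) (2 * k) = dyadic n k := by
  unfold dyadic
  push_cast
  field_simp
  ring

theorem dyadic_le_of_dyadicIndex (n : ℕ) (t : ℝ≥0) : dyadic n (dyadicIndex n t) ≤ t := by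
  rw [dyadic, div_le_iff₀ (by positivity), mul_comm]
  exact Nat.floor_le (by positivity)

theorem lt_dyadic_dyadicIndex_succ (n : ℕ) (t : ℝ≥0) : t < dyadic n (dyadicIndex n t + 1) := by
  rw [dyadic, lt_div_iff₀ (by positivity), mul_comm]
  push_cast
  exact Nat.lt_floor_add_one _

theorem dyadicIndex_lt {n N : ℕ} {t : ℝ≥0} (ht : t < N) : dyadicIndex n t < N * 2 ^ n := by
  rw [dyadicIndex, Nat.floor_lt (by positivity)]
  push_cast
  rw [mul_comm]
  exact mul_lt_mul_of_pos_right ht (by positivity)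

theorem dyadicIndex_succ (n : ℕ) (t : ℝ≥0) :
    dyadicIndex (n + 1) t = 2 * dyadicIndex n t ∨
      dyadicIndex (n + 1) t = 2 * dyadicIndex n t + 1 := by
  have h1 : 2 * dyadicIndex n t ≤ dyadicIndex (n + 1) t := by
    refine Nat.le_floor ?_
    have := Nat.floor_le (a := 2 ^ n * t) (by positivity)
    push_cast
    rw [pow_succ', mul_assoc]
    exact mul_le_mul_of_nonneg_left this (by positivity)
  have h2 : dyadicIndex (n + 1) t < 2 * dyadicIndex n t + 2 := by
    rw [dyadicIndex, Nat.floor_lt (by positivity)]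
    have := Nat.lt_floor_add_one (2 ^ n * t)
    push_cast
    rw [pow_succ', mul_assoc, show (2 : ℝ≥0) * (dyadicIndex n t) + 2
      = 2 * ((dyadicIndex n t) + 1) by ring]
    exact mul_lt_mul_of_pos_left this (by positivity)
  omega

theorem dyadicIndex_eq_or_succ {n : ℕ} {s t : ℝ≥0} (hst : s ≤ t) (h : 2 ^ n * t < 2 ^ n * s + 1) :
    dyadicIndex n t = dyadicIndex n s ∨ dyadicIndex n t = dyadicIndex n s + 1 := by
  have h1 : dyadicIndex n s ≤ dyadicIndex n t := Nat.floor_mono (by gcongr)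
  have h2 : dyadicIndex n t < dyadicIndex n s + 2 := by
    rw [dyadicIndex, Nat.floor_lt (by positivity)]
    have := Nat.lt_floor_add_one (2 ^ n * s)
    push_cast
    calc 2 ^ n * t < 2 ^ n * s + 1 := h
      _ < (⌊2 ^ n * s⌋₊ + 1) + 1 := by gcongr
      _ = _ := by rw [dyadicIndex]; ring
  omega

/-- A function on the dyadic numbers with geometrically small increments extends continuously. -/
theorem exists_continuous_of_dyadic_increments {f : ℝ≥0 → ℂ} {r : ℝ} (hr0 : 0 ≤ r) (hr1 : r < 1)
    (h : ∀ N : ℕ, ∃ B : ℝ, ∀ n k : ℕ, k < N * 2 ^ n →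
      ‖f (dyadic n (k + 1)) - f (dyadic n k)‖ ≤ B * r ^ n) :
    ∃ g : ℝ≥0 → ℂ, Continuous g ∧
      ∀ t, Tendsto (fun n => f (dyadic n (dyadicIndex n t))) atTop (𝓝 (g t)) := by
  choose B hB using h
  have hB0 : ∀ N : ℕ, 0 < N → 0 ≤ B N := fun N hN => by
    have := hB N 0 0 (by positivity)
    rw [pow_zero, mul_one] at this
    exact (norm_nonneg _).trans this
  have hstep : ∀ (N : ℕ) (t : ℝ≥0), t < N → ∀ n : ℕ,
      dist (f (dyadic n (dyadicIndex n t))) (f (dyadic (n + 1) (dyadicIndex (n + 1) t)))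
        ≤ B N * r ^ n := by
    intro N t ht n
    have hN : 0 < N := by
      rcases Nat.eq_zero_or_pos N with rfl | hN
      · simp at ht
      · exact hN
    have hpos : 0 ≤ B N * r ^ n := mul_nonneg (hB0 N hN) (pow_nonneg hr0 n)
    -- Refining the approximation of `t` by one level either leaves the dyadic point unchanged or
    -- moves it by one step of the finer level.
    rcases dyadicIndex_succ n t with h1 | h1
    · rw [h1, dyadic_succ_two_mul, dist_self]
      exact hpos
    · rw [dist_comm, dist_eq_norm, h1, ← dyadic_succ_two_mul n]
      refine (hB N (n + 1) _ ?_).trans ?_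
      · have := dyadicIndex_lt (n := n + 1) ht
        omega
      · rw [pow_succ, ← mul_assoc]
        exact mul_le_of_le_one_right hpos hr1.le
  have hex : ∀ t : ℝ≥0, ∃ y, Tendsto (fun n => f (dyadic n (dyadicIndex n t))) atTop (𝓝 y) := by
    intro t
    obtain ⟨N, hN⟩ := exists_nat_gt t
    exact cauchySeq_tendsto_of_complete (cauchySeq_of_le_geometric r (B N) hr1 (hstep N t hN))
  choose g hg using hex
  refine ⟨g, continuous_iff_continuousAt.mpr fun t₀ => ?_, hg⟩
  obtain ⟨N, hN⟩ := exists_nat_gt (t₀ + 1)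
  have hdist : ∀ t : ℝ≥0, t < N → ∀ n,
      dist (f (dyadic n (dyadicIndex n t))) (g t) ≤ B N * r ^ n / (1 - r) := fun t ht n =>
    dist_le_of_le_geometric_of_tendsto r (B N) hr1 (hstep N t ht) (hg t) n
  -- Points closer than `2⁻ⁿ` lie in the same or in adjacent dyadic intervals of level `n`, so one
  -- increment separates their approximations.
  have hclose : ∀ s t : ℝ≥0, s ≤ t → t < N → ∀ n : ℕ, 2 ^ n * t < 2 ^ n * s + 1 →
      dist (f (dyadic n (dyadicIndex n s))) (f (dyadic n (dyadicIndex n t))) ≤ B N * r ^ n := by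
    intro s t hst ht n hn
    have hNpos : 0 < N := by
      rcases Nat.eq_zero_or_pos N with rfl | hN
      · simp at ht
      · exact hN
    rcases dyadicIndex_eq_or_succ hst hn with h1 | h1
    · rw [h1, dist_self]
      exact mul_nonneg (hB0 N hNpos) (pow_nonneg hr0 n)
    · rw [h1, dist_comm, dist_eq_norm]
      exact hB N n _ (dyadicIndex_lt (hst.trans_lt ht))
  have hlim : Tendsto (fun n : ℕ => B N * r ^ n / (1 - r) + B N * r ^ n + B N * r ^ n / (1 - r))
      atTop (𝓝 0) := by
    have h0 := (tendsto_pow_atTop_nhds_zero_of_lt_one hr0 hr1).const_mul (B N)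
    have h1 := h0.div_const (1 - r)
    simpa using (h1.add h0).add h1
  rw [Metric.continuousAt_iff]
  intro ε hε
  obtain ⟨n, hn⟩ := (hlim.eventually (gt_mem_nhds hε)).exists
  refine ⟨min 1 ((2 ^ n)⁻¹), by positivity, fun {t} ht => ?_⟩
  have ht1 : dist t t₀ < 1 := ht.trans_le (min_le_left _ _)
  have ht2 : dist t t₀ < (2 ^ n)⁻¹ := ht.trans_le (min_le_right _ _)
  rw [NNReal.dist_eq] at ht1 ht2
  have htN : t < N := by
    refine lt_trans ?_ hN
    rw [← NNReal.coe_lt_coe]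
    push_cast
    linarith [(abs_lt.mp ht1).2]
  have ht₀N : t₀ < N := lt_of_le_of_lt (by simp) hN
  have hnear : ∀ a b : ℝ≥0, |(a : ℝ) - b| < (2 ^ n)⁻¹ → 2 ^ n * a < 2 ^ n * b + 1 := by
    intro a b hab
    rw [← NNReal.coe_lt_coe]
    push_cast
    have h2 : (0 : ℝ) < 2 ^ n := by positivity
    have h3 := (abs_lt.mp hab).2
    have h4 : (2 : ℝ) ^ n * (a - b) < 2 ^ n * (2 ^ n)⁻¹ := mul_lt_mul_of_pos_left h3 h2
    rw [mul_inv_cancel₀ h2.ne'] at h4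
    linarith
  have hmid : dist (f (dyadic n (dyadicIndex n t))) (f (dyadic n (dyadicIndex n t₀)))
      ≤ B N * r ^ n := by
    rcases le_total t t₀ with hle | hle
    · exact hclose t t₀ hle ht₀N n (hnear t₀ t (by rwa [abs_sub_comm]))
    · rw [dist_comm]
      exact hclose t₀ t hle htN n (hnear t t₀ ht2)
  have e1 := hdist t htN n
  have e2 := hdist t₀ ht₀N n
  rw [dist_comm] at e1
  calc dist (g t) (g t₀) ≤ dist (g t) (f (dyadic n (dyadicIndex n t)))
        + dist (f (dyadic n (dyadicIndex n t))) (f (dyadic n (dyadicIndex n t₀)))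
        + dist (f (dyadic n (dyadicIndex n t₀))) (g t₀) := dist_triangle4 _ _ _ _
    _ < ε := by linarith

section Kolmogorov

variable {Ω : Type*} [MeasurableSpace Ω] {P : Measure Ω} {X : ℝ≥0 → Ω → ℂ}

theorem ae_exists_dyadic_increments (hX : ∀ t, Measurable (X t)) {C : ℝ≥0∞} (hC : C ≠ ∞)
    (h : ∀ s t : ℝ≥0, s ≤ t → ∫⁻ x, ‖X t x - X s x‖ₑ ^ 4 ∂P ≤ C * ((t - s : ℝ≥0) : ℝ≥0∞) ^ 2)
    (N : ℕ) : ∀ᵐ x ∂P, ∃ B : ℝ, ∀ n k : ℕ, k < N * 2 ^ n →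
      ‖X (dyadic n (k + 1)) x - X (dyadic n k) x‖ ≤ B * (10 / 11 : ℝ) ^ n := by
  set D : ℕ → Ω → ℝ≥0∞ := fun n x =>
    ∑ k ∈ Finset.range (N * 2 ^ n), ‖X (dyadic n (k + 1)) x - X (dyadic n k) x‖ₑ ^ 4 with hD
  -- The sum of fourth powers at level `n` has expectation `O(2⁻ⁿ)`. Any `q > 1` with `q⁴ < 2` keeps
  -- the weighted series summable and gives increments of order `q⁻ⁿ`.
  set q : ℝ≥0 := 11 / 10 with hq
  have hmeas : ∀ n k, Measurable fun x => ‖X (dyadic n (k + 1)) x - X (dyadic n k) x‖ₑ ^ 4 :=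
    fun n k => ((hX _).sub (hX _)).enorm.pow_const 4
  have hDm : ∀ n, Measurable (D n) := fun n => Finset.measurable_sum _ fun k _ => hmeas n k
  have hDint : ∀ n, ∫⁻ x, D n x ∂P ≤ C * N * (((2 ^ n)⁻¹ : ℝ≥0) : ℝ≥0∞) := by
    intro n
    rw [hD]
    simp only
    rw [lintegral_finsetSum _ fun k _ => hmeas n k]
    have hincr : ∀ k, ∫⁻ x, ‖X (dyadic n (k + 1)) x - X (dyadic n k) x‖ₑ ^ 4 ∂P
        ≤ C * (((2 ^ n)⁻¹ : ℝ≥0) : ℝ≥0∞) ^ 2 := fun k => by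
      have hsub : dyadic n (k + 1) = dyadic n k + (2 ^ n)⁻¹ := by
        unfold dyadic
        push_cast
        field_simp
      have := h (dyadic n k) (dyadic n (k + 1)) (by rw [hsub]; simp)
      rwa [hsub, add_tsub_cancel_left, ← hsub] at this
    refine (Finset.sum_le_sum fun k _ => hincr k).trans (le_of_eq ?_)
    rw [Finset.sum_const, Finset.card_range, nsmul_eq_mul]
    have e : (((N * 2 ^ n : ℕ) : ℝ≥0) * (2 ^ n)⁻¹ ^ 2 : ℝ≥0) = N * (2 ^ n)⁻¹ := by
      push_cast
      field_simp
    have e' := congrArg (fun y : ℝ≥0 => (y : ℝ≥0∞)) e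
    simp only [ENNReal.coe_mul, ENNReal.coe_pow, ENNReal.coe_natCast] at e'
    rw [mul_left_comm, e', ← mul_assoc]
  have hsum : ∫⁻ x, ∑' n, (((q ^ 4) ^ n : ℝ≥0) : ℝ≥0∞) * D n x ∂P ≠ ∞ := by
    rw [lintegral_tsum fun n => ((hDm n).const_mul _).aemeasurable]
    have hle : ∑' n, ∫⁻ x, (((q ^ 4) ^ n : ℝ≥0) : ℝ≥0∞) * D n x ∂P
        ≤ ∑' n : ℕ, C * N * ((((q ^ 4 / 2) ^ n : ℝ≥0)) : ℝ≥0∞) := by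
      refine ENNReal.tsum_le_tsum fun n => ?_
      rw [lintegral_const_mul _ (hDm n)]
      calc _ ≤ (((q ^ 4) ^ n : ℝ≥0) : ℝ≥0∞) * (C * N * (((2 ^ n)⁻¹ : ℝ≥0) : ℝ≥0∞)) := by
            gcongr
            exact hDint n
        _ = C * N * ((((q ^ 4) ^ n : ℝ≥0) : ℝ≥0∞) * (((2 ^ n)⁻¹ : ℝ≥0) : ℝ≥0∞)) := by ring
        _ = _ := by rw [← ENNReal.coe_mul, div_pow (q ^ 4) 2 n, div_eq_mul_inv ((q ^ 4) ^ n)]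
    refine ne_top_of_le_ne_top ?_ hle
    rw [ENNReal.tsum_mul_left]
    refine ENNReal.mul_ne_top (ENNReal.mul_ne_top hC (ENNReal.natCast_ne_top N)) ?_
    refine ENNReal.tsum_coe_ne_top_iff_summable.mpr (NNReal.summable_geometric ?_)
    rw [hq, ← NNReal.coe_lt_coe]
    push_cast
    norm_num
  have hae := ae_lt_top (Measurable.tsum fun n => (hDm n).const_mul _) hsum
  filter_upwards [hae] with x hx
  set S := ∑' n, (((q ^ 4) ^ n : ℝ≥0) : ℝ≥0∞) * D n x with hS
  -- With `B ≥ 1` one has `S ≤ B ≤ B⁴`, so no fourth root of `S` is needed.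
  set B : ℝ := max 1 S.toReal with hBdef
  have hB1 : 1 ≤ B := le_max_left _ _
  refine ⟨B, fun n k hk => ?_⟩
  have h1 : (((q ^ 4) ^ n : ℝ≥0) : ℝ≥0∞) * ‖X (dyadic n (k + 1)) x - X (dyadic n k) x‖ₑ ^ 4
      ≤ S := by
    refine le_trans ?_ (ENNReal.le_tsum n)
    gcongr
    exact Finset.single_le_sum (f := fun k => ‖X (dyadic n (k + 1)) x - X (dyadic n k) x‖ₑ ^ 4)
      (fun _ _ => zero_le) (Finset.mem_range.mpr hk)
  have h2 := ENNReal.toReal_mono hx.ne h1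
  rw [ENNReal.toReal_mul, ENNReal.toReal_pow, toReal_enorm, ENNReal.coe_toReal] at h2
  set d := ‖X (dyadic n (k + 1)) x - X (dyadic n k) x‖
  have h3 : ((11 / 10 : ℝ) ^ n * d) ^ 4 ≤ B ^ 4 := by
    calc ((11 / 10 : ℝ) ^ n * d) ^ 4 = ((11 / 10 : ℝ) ^ 4) ^ n * d ^ 4 := by
          rw [mul_pow, ← pow_mul, ← pow_mul, mul_comm n]
      _ ≤ S.toReal := by
          refine le_trans (le_of_eq ?_) h2
          rw [hq]
          push_cast
          rfl
      _ ≤ B := le_max_right _ _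
      _ ≤ B ^ 4 := le_self_pow₀ hB1 (by norm_num)
  have h4 : (11 / 10 : ℝ) ^ n * d ≤ B :=
    le_of_pow_le_pow_left₀ (by norm_num) (by positivity) h3
  have h5 : (10 / 11 : ℝ) ^ n = ((11 / 10 : ℝ) ^ n)⁻¹ := by rw [← inv_pow]; norm_num
  rw [h5, ← div_eq_mul_inv, le_div_iff₀ (by positivity), mul_comm]
  exact h4

/-- The Kolmogorov continuity criterion for fourth moments. -/
theorem exists_continuous_version (hX : ∀ t, Measurable (X t)) {C : ℝ≥0∞} (hC : C ≠ ∞)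
    (h : ∀ s t : ℝ≥0, s ≤ t → ∫⁻ x, ‖X t x - X s x‖ₑ ^ 4 ∂P ≤ C * ((t - s : ℝ≥0) : ℝ≥0∞) ^ 2) :
    ∃ Y : ℝ≥0 → Ω → ℂ, (∀ t, Measurable (Y t)) ∧ (∀ t, Y t =ᵐ[P] X t) ∧
      ∀ᵐ x ∂P, Continuous fun t => Y t x := by
  classical
  have hgood : ∀ᵐ x ∂P, ∃ g : ℝ≥0 → ℂ, Continuous g ∧
      ∀ t, Tendsto (fun n => X (dyadic n (dyadicIndex n t)) x) atTop (𝓝 (g t)) := by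
    filter_upwards [ae_all_iff.mpr (ae_exists_dyadic_increments hX hC h)] with x hx
    exact exists_continuous_of_dyadic_increments (f := fun t => X t x) (r := 10 / 11)
      (by norm_num) (by norm_num) hx
  -- The set of good outcomes need not be measurable; a measurable subset of full measure keeps each
  -- `Y t` measurable.
  obtain ⟨G, hGsub, hGm, hG0⟩ : ∃ G : Set Ω, (∀ x ∈ G, ∃ g : ℝ≥0 → ℂ, Continuous g ∧
      ∀ t, Tendsto (fun n => X (dyadic n (dyadicIndex n t)) x) atTop (𝓝 (g t))) ∧
      MeasurableSet G ∧ ∀ᵐ x ∂P, x ∈ G := by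
    obtain ⟨s, hs, hsm, hs0⟩ := exists_measurable_superset_of_null hgood
    refine ⟨sᶜ, fun x hx => ?_, hsm.compl, ?_⟩
    · by_contra hx'
      exact hx (hs hx')
    · rw [ae_iff]
      simpa using hs0
  choose! g hgc hgt using hGsub
  refine ⟨fun t x => if x ∈ G then g x t else 0, fun t => ?_, fun t => ?_, ?_⟩
  · refine measurable_of_tendsto_metrizable
      (f := fun n x => if x ∈ G then X (dyadic n (dyadicIndex n t)) x else 0)
      (fun n => Measurable.ite hGm (hX _) measurable_const) ?_
    rw [tendsto_pi_nhds]
    intro x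
    by_cases hx : x ∈ G
    · simpa [hx] using hgt x hx t
    · simp [hx]
  · have hmeas : ∀ n, Measurable fun x => ‖X t x - X (dyadic n (dyadicIndex n t)) x‖ₑ ^ 4 :=
      fun n => ((hX _).sub (hX _)).enorm.pow_const 4
    -- The dyadic approximations lie within `2⁻ⁿ` of `t`, so the expected fourth powers are
    -- summable. Hence they converge almost surely to `X t`, which identifies the limit.
    have hsum : ∫⁻ x, ∑' n, ‖X t x - X (dyadic n (dyadicIndex n t)) x‖ₑ ^ 4 ∂P ≠ ∞ := by
      rw [lintegral_tsum fun n => (hmeas n).aemeasurable]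
      have hle : ∑' n, ∫⁻ x, ‖X t x - X (dyadic n (dyadicIndex n t)) x‖ₑ ^ 4 ∂P
          ≤ ∑' n : ℕ, C * (((4⁻¹ : ℝ≥0) ^ n : ℝ≥0) : ℝ≥0∞) := by
        refine ENNReal.tsum_le_tsum fun n => ?_
        refine (h _ t (dyadic_le_of_dyadicIndex n t)).trans ?_
        rw [← ENNReal.coe_pow]
        refine mul_le_mul_of_nonneg_left (ENNReal.coe_le_coe.mpr ?_) zero_le
        have h1 : t - dyadic n (dyadicIndex n t) ≤ (2 ^ n)⁻¹ := by
          rw [tsub_le_iff_left]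
          refine (lt_dyadic_dyadicIndex_succ n t).le.trans (le_of_eq ?_)
          unfold dyadic
          push_cast
          field_simp
        calc _ ≤ ((2 ^ n)⁻¹ : ℝ≥0) ^ 2 := pow_le_pow_left₀ (by positivity) h1 2
          _ = (4⁻¹ : ℝ≥0) ^ n := by
            rw [← inv_pow, ← pow_mul, mul_comm, pow_mul, inv_pow]
            norm_num
      refine ne_top_of_le_ne_top ?_ hle
      rw [ENNReal.tsum_mul_left]
      refine ENNReal.mul_ne_top hC ?_
      refine ENNReal.tsum_coe_ne_top_iff_summable.mpr (NNReal.summable_geometric ?_)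
      rw [← NNReal.coe_lt_coe]
      push_cast
      norm_num
    have hae := ae_lt_top (Measurable.tsum hmeas) hsum
    filter_upwards [hae, hG0] with x hx hxG
    simp only [hxG, if_true]
    refine tendsto_nhds_unique (hgt x hxG t) ?_
    have h1 := ENNReal.tendsto_atTop_zero_of_tsum_ne_top hx.ne
    rw [tendsto_iff_norm_sub_tendsto_zero]
    have h2 : Tendsto (fun n => ‖X t x - X (dyadic n (dyadicIndex n t)) x‖ ^ 4) atTop (𝓝 0) := by
      have := (ENNReal.tendsto_toReal ENNReal.zero_ne_top).comp h1
      simpa [Function.comp_def] using this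
    have h3 := h2.rpow_const (p := 1 / 4) (Or.inr (by norm_num))
    rw [Real.zero_rpow (by norm_num)] at h3
    refine h3.congr fun n => ?_
    rw [norm_sub_rev, one_div, show (4 : ℝ) = ((4 : ℕ) : ℝ) by norm_num,
      Real.pow_rpow_inv_natCast (norm_nonneg _) (by norm_num)]
  · filter_upwards [hG0] with x hx
    simpa [hx] using hgc x hx

end Kolmogorov

/-! ### Second and fourth moments of the increments of the position. -/

section Position

variable {Ω : Type*} [MeasurableSpace Ω] {P : Measure Ω} {ν : Measure ℝ} {c : ℝ≥0}

theorem GaussianRandomMeasure.integral_norm_sq_position_sub_le (ξ : GaussianRandomMeasure ν P)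
    (hν : ν ≤ c • volume) (s t : ℝ≥0) :
    ∫ x, ‖ξ.position t x - ξ.position s x‖ ^ 2 ∂P ≤ c * (4 * Real.pi * |(t : ℝ) - s|) := by
  refine le_trans (le_of_eq ?_) (ξ.norm_sq_position_sub_le hν s t)
  rw [← Lp_integral_norm_sq]
  refine integral_congr_ae ((Lp.coeFn_sub (ξ.position t) (ξ.position s)).mono fun x hx => ?_)
  simp only [hx, Pi.sub_apply]

/-- An increment is itself a stochastic integral, so its fourth moment is controlled by its squared
variance. This produces the exponent `2 > 1` needed for continuity. -/
theorem GaussianRandomMeasure.lintegral_enorm_position_sub_pow_four_le [IsProbabilityMeasure P]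
    (ξ : GaussianRandomMeasure ν P) (hν : ν ≤ c • volume) {s t : ℝ≥0} (hst : s ≤ t) :
    ∫⁻ x, ‖ξ.position t x - ξ.position s x‖ₑ ^ 4 ∂P
      ≤ ENNReal.ofReal (2 * normalFourthMoment * (c * (4 * Real.pi)) ^ 2)
        * ((t - s : ℝ≥0) : ℝ≥0∞) ^ 2 := by
  have hκ := normalFourthMoment_nonneg
  have h1 : ∫⁻ x, ‖ξ.position t x - ξ.position s x‖ₑ ^ 4 ∂P
      = ∫⁻ x, ‖(ξ.position t - ξ.position s) x‖ₑ ^ 4 ∂P := by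
    refine lintegral_congr_ae ?_
    filter_upwards [Lp.coeFn_sub (ξ.position t) (ξ.position s)] with x hx
    rw [hx, Pi.sub_apply]
  have h2 : ∫⁻ x, ‖(ξ.position t - ξ.position s) x‖ₑ ^ 4 ∂P
      ≤ ENNReal.ofReal (2 * normalFourthMoment) * ‖ξ.position t - ξ.position s‖ₑ ^ 4 := by
    rw [ξ.position_eq hν t, ξ.position_eq hν s, ← map_sub]
    exact ξ.lintegral_enorm_integralL2_pow_four_le _
  have h3 := ξ.norm_sq_position_sub_le hν s t
  have h4 : |(t : ℝ) - s| = ((t - s : ℝ≥0) : ℝ) := by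
    rw [NNReal.coe_sub hst, abs_of_nonneg (sub_nonneg.mpr (NNReal.coe_le_coe.mpr hst))]
  rw [h4] at h3
  rw [h1]
  refine h2.trans ?_
  rw [← ofReal_norm, ← ENNReal.ofReal_pow (norm_nonneg _), ← ENNReal.ofReal_mul
    (mul_nonneg zero_le_two hκ), ← ENNReal.ofReal_coe_nnreal, ← ENNReal.ofReal_pow (by positivity),
    ← ENNReal.ofReal_mul (mul_nonneg (mul_nonneg zero_le_two hκ) (sq_nonneg _))]
  refine ENNReal.ofReal_le_ofReal ?_
  rw [mul_assoc (2 * normalFourthMoment) ((c * (4 * Real.pi)) ^ 2 : ℝ), ← mul_pow, show (4 : ℕ) = 2 * 2 from rfl, pow_mul]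
  refine mul_le_mul_of_nonneg_left ?_ (mul_nonneg zero_le_two hκ)
  refine (pow_le_pow_left₀ (sq_nonneg _) h3 2).trans (le_of_eq ?_)
  ring

end Position

end GLE

end

/-! ### Assembly of the theorem. -/

theorem mainTheorem11 {Ω : Type*} [MeasurableSpace Ω] (P : Measure Ω) [IsProbabilityMeasure P]
    (K : ℝ → ℝ) (hK : GLE.AdmissibleKernel K) (lam β : ℝ) (hlam : 0 < lam) (hβ : 0 ≤ β)
    (W F : GLE.StationaryRandomDistribution P) (hW : GLE.IsWhiteNoise W)
    (hF : GLE.HasCovarianceKernel F K)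
    (ν : Measure ℝ) (ξ : GLE.GaussianRandomMeasure ν P)
    (hV : GLE.IsWeakSolution 0 lam β K W F ξ) :
    ν Set.univ = ∞ ∧
    (∀ t : ℝ, TemperedDistribution.delta t ∉ GLE.Dom ν) ∧
    (∀ t : ℝ≥0, GLE.IsTempered (GLE.indicatorIcc t) ∧
      GLE.ofFun (GLE.indicatorIcc t) ∈ GLE.Dom ν) ∧
    (∀ T : ℝ≥0, ∃ C : ℝ, 0 < C ∧ ∀ s t : ℝ≥0, s ≤ T → t ≤ T →
      ∫ x, ‖ξ.position t x - ξ.position s x‖ ^ 2 ∂P ≤ C * |(t : ℝ) - s| ^ (1 / 2 : ℝ)) ∧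
    ∃ Y : ℝ≥0 → Ω → ℂ, (∀ t, Measurable (Y t)) ∧ (∀ t, Y t =ᵐ[P] ξ.position t) ∧
      ∀ᵐ x ∂P, Continuous fun t => Y t x := by
  have huniv := GLE.spectralMeasure_univ hK hlam hβ hW hF hV
  have hν : ν ≤ (8 / (Real.pi * lam)).toNNReal • (volume : Measure ℝ) :=
    GLE.spectralMeasure_le hK hlam hβ hW hF hV
  set c := (8 / (Real.pi * lam)).toNNReal
  refine ⟨huniv, GLE.delta_notMem_Dom hV.isSpectralMeasure.absolutelyContinuous huniv,
    fun t => ⟨GLE.isTempered_indicatorIcc t, GLE.ofFun_indicatorIcc_mem_Dom hν t.coe_nonneg⟩,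
    fun T => ?_, ?_⟩
  · refine ⟨c * (4 * Real.pi) * Real.sqrt T + 1, by positivity, fun s t hs ht => ?_⟩
    refine (ξ.integral_norm_sq_position_sub_le hν s t).trans ?_
    set d := |(t : ℝ) - s|
    have hd : 0 ≤ d := abs_nonneg _
    have hdT : d ≤ T := by
      have h1 : (s : ℝ) ≤ T := hs
      have h2 : (t : ℝ) ≤ T := ht
      exact abs_sub_le_iff.mpr ⟨by linarith [s.coe_nonneg], by linarith [t.coe_nonneg]⟩
    rw [← Real.sqrt_eq_rpow]
    have h3 : d ≤ Real.sqrt T * Real.sqrt d := by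
      calc d = Real.sqrt d * Real.sqrt d := (Real.mul_self_sqrt hd).symm
        _ ≤ _ := by gcongr
    calc c * (4 * Real.pi * d) = c * (4 * Real.pi) * d := by ring
      _ ≤ c * (4 * Real.pi) * (Real.sqrt T * Real.sqrt d) := by gcongr
      _ ≤ (c * (4 * Real.pi) * Real.sqrt T + 1) * Real.sqrt d := by
        nlinarith [Real.sqrt_nonneg d]
  · exact GLE.exists_continuous_version (fun t => (Lp.stronglyMeasurable _).measurable)
      ENNReal.ofReal_ne_top fun s t hst => ξ.lintegral_enorm_position_sub_pow_four_le hν hst
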